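/- **Theorem.** In \textsc{Maximum Happy Vertices} the input is a finite simple undirected graph $G$, a number $\ell$ of colors, a partial coloring $p:S\to[\ell]=\{1,\dots,\ell\}$ with $S\subseteq V(G)$, and an integer $k$; the question is whether there is a coloring $c:V(G)\to[\ell]$ extending $p$ with at least $k$ happy vertices, where a vertex is happy if all its neighbours have the same color as the vertex itself. A cluster graph is a disjoint union of cliques. The distance to cluster $d$ of $G$ is the minimum size of a set $S\subseteq V(G)$ such that $G\setminus S$ is a cluster graph. \textsc{Maximum Happy Vertices} can be solved in $\mathcal{O}^*((2d)^d)$ time, where $d$ is the distance to cluster of the input graph (and $0^0=1$). That is, there are a deterministic algorithm and a polynomial $q$ such that the algorithm decides every instance $(G,p,k)$, without being given $d$ or a deletion set, in at most $(2d)^d\cdot q(n)$ steps, where $n=|V(G)|$. Steps are counted on a random access machine with unit-cost instructions whose only arithmetic operations are successor and predecessor. The input consists of $n$, $\ell$, $k$, the adjacency matrix of $G$ and the list of precolors. -/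

import Mathlib

/-! ### The machine model: a successor random access machine with a step count -/

/-- A configuration of the random access machine: registers `reg 0, reg 1, …` and memory banks
`mem 0, mem 1, …`, each bank being an infinite array of natural numbers. A program mentions
only finitely many registers and banks. -/
structure RamState where
  reg : ℕ → ℕ
  mem : ℕ → ℕ → ℕ

/-- `s.setReg r v` is `s` with the value `v` written into register `r`. -/
def RamState.setReg (s : RamState) (r v : ℕ) : RamState :=
  { s with reg := Function.update s.reg r v }

/-- `s.setMem b i v` is `s` with the value `v` written into cell `i` of bank `b`. -/
def RamState.setMem (s : RamState) (b i v : ℕ) : RamState :=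
  { s with mem := Function.update s.mem b (Function.update (s.mem b) i v) }

/-- The tests of the machine compare the contents of two registers. -/
inductive RamTest where
  | eq (r r' : ℕ)
  | ne (r r' : ℕ)
  | lt (r r' : ℕ)
  | le (r r' : ℕ)

/-- The truth value of a test in a configuration. -/
def RamTest.Holds (s : RamState) : RamTest → Prop
  | .eq r r' => s.reg r = s.reg r'
  | .ne r r' => s.reg r ≠ s.reg r'
  | .lt r r' => s.reg r < s.reg r'
  | .le r r' => s.reg r ≤ s.reg r'

/-- Programs of the machine. The only arithmetic instructions are successor and (truncated)
predecessor, so that `t` steps raise the largest number in the store by at most `t` beyond the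
constants of the program; hence counting every instruction as one step is realistic. -/
inductive RamProgram where
  /-- do nothing -/
  | skip
  /-- `reg r := v`, for a constant `v` -/
  | const (r v : ℕ)
  /-- `reg r := reg r'` -/
  | copy (r r' : ℕ)
  /-- `reg r := reg r + 1` -/
  | inc (r : ℕ)
  /-- `reg r := reg r - 1` (and `0 - 1 = 0`) -/
  | dec (r : ℕ)
  /-- `reg r := mem b (reg r')` -/
  | load (r b r' : ℕ)
  /-- `mem b (reg r') := reg r` -/
  | store (b r' r : ℕ)
  /-- sequential composition -/
  | seq (P Q : RamProgram)
  /-- if the test holds then `P` else `Q` -/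
  | branch (c : RamTest) (P Q : RamProgram)
  /-- while the test holds do `P` -/
  | loop (c : RamTest) (P : RamProgram)

/-- `P.Run s s' t`: started in configuration `s`, the program `P` halts in configuration `s'`
after exactly `t` steps. Each execution of an instruction and each evaluation of a test is
one step. -/
inductive RamProgram.Run : RamProgram → RamState → RamState → ℕ → Prop
  | skip (s : RamState) : Run .skip s s 1
  | const (s : RamState) (r v : ℕ) : Run (.const r v) s (s.setReg r v) 1
  | copy (s : RamState) (r r' : ℕ) : Run (.copy r r') s (s.setReg r (s.reg r')) 1
  | inc (s : RamState) (r : ℕ) : Run (.inc r) s (s.setReg r (s.reg r + 1)) 1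
  | dec (s : RamState) (r : ℕ) : Run (.dec r) s (s.setReg r (s.reg r - 1)) 1
  | load (s : RamState) (r b r' : ℕ) :
      Run (.load r b r') s (s.setReg r (s.mem b (s.reg r'))) 1
  | store (s : RamState) (b r' r : ℕ) :
      Run (.store b r' r) s (s.setMem b (s.reg r') (s.reg r)) 1
  | seq {P Q : RamProgram} {s s₁ s₂ : RamState} {t₁ t₂ : ℕ} :
      Run P s s₁ t₁ → Run Q s₁ s₂ t₂ → Run (.seq P Q) s s₂ (t₁ + t₂)
  | branch_true {c : RamTest} {P Q : RamProgram} {s s₁ : RamState} {t : ℕ} :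
      c.Holds s → Run P s s₁ t → Run (.branch c P Q) s s₁ (1 + t)
  | branch_false {c : RamTest} {P Q : RamProgram} {s s₁ : RamState} {t : ℕ} :
      ¬ c.Holds s → Run Q s s₁ t → Run (.branch c P Q) s s₁ (1 + t)
  | loop_true {c : RamTest} {P : RamProgram} {s s₁ s₂ : RamState} {t₁ t₂ : ℕ} :
      c.Holds s → Run P s s₁ t₁ → Run (.loop c P) s₁ s₂ t₂ →
        Run (.loop c P) s s₂ (1 + t₁ + t₂)
  | loop_false {c : RamTest} {P : RamProgram} {s : RamState} :
      ¬ c.Holds s → Run (.loop c P) s s 1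

/-- The machine is deterministic: the final configuration and the number of steps are
determined by the program and the initial configuration. -/
theorem RamProgram.Run.deterministic {P : RamProgram} {s s₁ s₂ : RamState} {t₁ t₂ : ℕ}
    (h₁ : P.Run s s₁ t₁) (h₂ : P.Run s s₂ t₂) : s₁ = s₂ ∧ t₁ = t₂ := by
  induction h₁ generalizing s₂ t₂ with
  | skip | const | copy | inc | dec | load | store => cases h₂; exact ⟨rfl, rfl⟩
  | seq _ _ ih₁ ih₂ =>
    cases h₂ with
    | seq a b =>
      obtain ⟨rfl, rfl⟩ := ih₁ a
      obtain ⟨rfl, rfl⟩ := ih₂ b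
      exact ⟨rfl, rfl⟩
  | branch_true hc _ ih =>
    cases h₂ with
    | branch_true _ a => obtain ⟨rfl, rfl⟩ := ih a; exact ⟨rfl, rfl⟩
    | branch_false hn _ => exact absurd hc hn
  | branch_false hc _ ih =>
    cases h₂ with
    | branch_true hn _ => exact absurd hn hc
    | branch_false _ a => obtain ⟨rfl, rfl⟩ := ih a; exact ⟨rfl, rfl⟩
  | loop_true hc _ _ ih₁ ih₂ =>
    cases h₂ with
    | loop_true _ a b =>
      obtain ⟨rfl, rfl⟩ := ih₁ a
      obtain ⟨rfl, rfl⟩ := ih₂ b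
      exact ⟨rfl, rfl⟩
    | loop_false hn => exact absurd hc hn
  | loop_false hc =>
    cases h₂ with
    | loop_true hn _ _ => exact absurd hn hc
    | loop_false _ => exact ⟨rfl, rfl⟩

/-- `P` decides the problem `L`, whose instances are presented to the machine by `enc`, within
`T x` steps on every instance `x`: it halts, with answer `1` in register `0` on yes-instances
and answer `0` in register `0` on no-instances. -/
def RamProgram.DecidesWithin {α : Type*} (P : RamProgram) (enc : α → RamState)
    (L : α → Prop) (T : α → ℕ) : Prop :=
  ∀ x : α, ∃ (s : RamState) (t : ℕ), P.Run (enc x) s t ∧ t ≤ T x ∧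
    (L x → s.reg 0 = 1) ∧ (¬ L x → s.reg 0 = 0)

/-! ### Distance to cluster graphs -/

/-- A cluster graph is a disjoint union of cliques: each connected component is a clique. -/
def IsClusterGraph {V : Type*} (G : SimpleGraph V) : Prop :=
  ∀ C : G.ConnectedComponent, G.IsClique C.supp

/-- `S` is a cluster modulator of `G` if deleting `S` from `G` leaves a cluster graph. -/
def IsClusterModulator {V : Type*} (G : SimpleGraph V) (S : Finset V) : Prop :=
  IsClusterGraph (G.induce ((S : Set V)ᶜ))

/-- The distance to cluster graphs: the size of a smallest cluster modulator. -/
noncomputable def distToCluster {V : Type*} (G : SimpleGraph V) : ℕ :=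
  sInf {d | ∃ S : Finset V, IsClusterModulator G S ∧ S.card = d}

/-- In a finite graph the smallest cluster modulator exists. -/
theorem exists_isClusterModulator_card_eq {V : Type*} [Fintype V] (G : SimpleGraph V) :
    ∃ S : Finset V, IsClusterModulator G S ∧ S.card = distToCluster G := by
  refine Nat.sInf_mem
    (s := {d | ∃ S : Finset V, IsClusterModulator G S ∧ S.card = d}) ⟨_, Finset.univ, ?_, rfl⟩
  rintro C ⟨u, hu⟩
  simp at hu

/-! ### Maximum Happy Vertices -/

/-- A vertex is happy with respect to a coloring if all its neighbours have its color. -/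
def IsHappy {V K : Type*} (G : SimpleGraph V) (c : V → K) (v : V) : Prop :=
  ∀ u, G.Adj v u → c u = c v

/-- An instance of Maximum Happy Vertices: a graph on `n` vertices, a number `ℓ` of colors,
a partial coloring `p` (`p v = none` if `v` is not precolored) and an integer `k`. -/
structure MHVInstance where
  n : ℕ
  G : SimpleGraph (Fin n)
  ℓ : ℕ
  p : Fin n → Option (Fin ℓ)
  k : ℤ

/-- `I` is a yes-instance: some coloring extends the partial coloring and makes at least `k`
vertices happy. -/
def MHVInstance.IsYes (I : MHVInstance) : Prop :=
  ∃ c : Fin I.n → Fin I.ℓ, (∀ v a, I.p v = some a → c v = a) ∧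
    I.k ≤ ({v | IsHappy I.G c v}.ncard : ℤ)

open Classical in
/-- The presentation of an instance to the machine. Registers `0, 1, 2, 3` hold the number of
vertices, the number of colors, the sign of `k` (`1` if `k < 0`, otherwise `0`) and `|k|`.
Bank `0` holds the adjacency matrix row by row, and bank `1` the partial coloring, with colors
numbered from `1` to `ℓ` and with `0` for a vertex that is not precolored. Everything else
is `0`. -/
noncomputable def MHVInstance.encode (I : MHVInstance) : RamState where
  reg := fun r =>
    if r = 0 then I.n
    else if r = 1 then I.ℓ
    else if r = 2 then (if I.k < 0 then 1 else 0)
    else if r = 3 then I.k.natAbs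
    else 0
  mem := fun b i =>
    if b = 0 then
      (if ∃ u v : Fin I.n, I.G.Adj u v ∧ i = u.val * I.n + v.val then 1 else 0)
    else if b = 1 then
      (if h : i < I.n then
        match I.p ⟨i, h⟩ with
        | none => 0
        | some a => a.val + 1
      else 0)
    else 0

/-! Let `d` be the distance to cluster. A graph is a cluster graph exactly when it has no induced
path on three vertices, so a modulator meets every such path. For `b = 0, 1, 2, …` all words of
length `b` over three letters are tried; the `j`-th letter says which vertex of the first remaining
path is deleted next. For `b = d` some word works (`Data.exists_word_p3Free`), so a list `S` with `b
≤ d` entries is found after at most `(d + 1) * 3 ^ d` words, and `3 ^ d ≤ 3 * (2 * d) ^ d`.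

All that is guessed about an optimal coloring `c` is which entries of `S` share a color and which
are happy. For each entry this is one of `2 * b` letters, hence `(2 * b) ^ b ≤ (2 * d) ^ d` guesses.
A guess forces into color classes the entries of `S` and all neighbours of those guessed to be
happy. The rest is greedy, because happiness asks only for equalities: two classes may receive the
same color without harm, so the classes can be treated independently. A class that contains a
precolored vertex has its color fixed. Any other class takes the precolor that makes the most
vertices happy among those that lie in precolored cliques and touch this class only. In a precolored
clique, vertices that are neither precolored nor forced take the color of a precolored vertex. A
clique without precolors takes the color of the class for which the most of its vertices touch no
other class; this choice does not depend on the colors of the classes. For a correct guess the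
result has at least as many happy vertices as `c` (`Data.Guess.count_happy_le`). A wrong guess is
harmless, since the constructed coloring is itself checked (`Loaded.isYes`).

For the step count, `Comp`, `CompP` and `Does` are closed under the usual constructions (variables,
bounded quantifiers, counting, least witness, filling an array), so each machine program is
assembled along the definition of what it computes. The words are enumerated by a counter in base
`B` (`search_spec`). -/

/-- `s` agrees with the abstract configuration `a` on the registers below `k` and on the memory. -/
def Agree (k : ℕ) (a s : RamState) : Prop :=
  (∀ r, r < k → s.reg r = a.reg r) ∧ s.mem = a.mem

theorem Agree.refl (k : ℕ) (a : RamState) : Agree k a a := ⟨fun _ _ => rfl, rfl⟩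

theorem Agree.trans {k : ℕ} {a b c : RamState} (h : Agree k a b) (h' : Agree k b c) :
    Agree k a c :=
  ⟨fun r hr => (h'.1 r hr).trans (h.1 r hr), h'.2.trans h.2⟩

theorem Agree.mono {k k' : ℕ} {a s : RamState} (h : Agree k a s) (hk : k' ≤ k) : Agree k' a s :=
  ⟨fun r hr => h.1 r (hr.trans_le hk), h.2⟩

theorem Agree.setReg_right {k : ℕ} {a s : RamState} (h : Agree k a s) {r : ℕ} (hr : k ≤ r)
    (v : ℕ) : Agree k a (s.setReg r v) := by
  refine ⟨fun j hj => ?_, h.2⟩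
  simp [RamState.setReg, Function.update_of_ne (show j ≠ r by omega), h.1 j hj]

theorem Agree.setReg {k : ℕ} {a s : RamState} (h : Agree k a s) (r v : ℕ) :
    Agree k (a.setReg r v) (s.setReg r v) := by
  refine ⟨fun j hj => ?_, h.2⟩
  by_cases hjr : j = r
  · subst hjr; simp [RamState.setReg]
  · simp [RamState.setReg, Function.update_of_ne hjr, h.1 j hj]

theorem Agree.setReg_succ {k : ℕ} {a s : RamState} (h : Agree k a s) (v : ℕ) :
    Agree (k + 1) (a.setReg k v) (s.setReg k v) := by
  refine ⟨fun j hj => ?_, h.2⟩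
  by_cases hjr : j = k
  · subst hjr; simp [RamState.setReg]
  · simp [RamState.setReg, Function.update_of_ne hjr, h.1 j (by omega)]

theorem Agree.setMem {k : ℕ} {a s : RamState} (h : Agree k a s) (b i v : ℕ) :
    Agree k (a.setMem b i v) (s.setMem b i v) := by
  refine ⟨fun j hj => h.1 j hj, ?_⟩
  simp [RamState.setMem, h.2]

theorem Agree.of_succ {k : ℕ} {a s : RamState} {v : ℕ} (h : Agree (k + 1) (a.setReg k v) s) :
    Agree k a s ∧ s.reg k = v := by
  refine ⟨⟨fun j hj => ?_, h.2⟩, ?_⟩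
  · rw [h.1 j (by omega)]
    simp [RamState.setReg, Function.update_of_ne (show j ≠ k by omega)]
  · rw [h.1 k (by omega)]
    simp [RamState.setReg]

/-! ### Time-bounded execution up to scratch registers -/

/-- On every configuration that agrees with `a` below register `k`, the program `P` halts within
`T` steps in a configuration that agrees with `a'` below register `k'`. -/
def Exec (k k' : ℕ) (P : RamProgram) (a a' : RamState) (T : ℕ) : Prop :=
  ∀ s, Agree k a s → ∃ s' t, P.Run s s' t ∧ t ≤ T ∧ Agree k' a' s'

theorem Exec.mono {k k' : ℕ} {P : RamProgram} {a a' : RamState} {T T' : ℕ}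
    (h : Exec k k' P a a' T) (hT : T ≤ T') : Exec k k' P a a' T' := by
  intro s hs
  obtain ⟨s', t, h1, h2, h3⟩ := h s hs
  exact ⟨s', t, h1, h2.trans hT, h3⟩

theorem Exec.weaken {k k' k'' : ℕ} {P : RamProgram} {a a' : RamState} {T : ℕ}
    (h : Exec k k' P a a' T) (hk : k'' ≤ k') : Exec k k'' P a a' T := by
  intro s hs
  obtain ⟨s', t, h1, h2, h3⟩ := h s hs
  exact ⟨s', t, h1, h2, h3.mono hk⟩

theorem Exec.seq {k k' k'' : ℕ} {P Q : RamProgram} {a a' a'' : RamState} {T T' : ℕ}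
    (h : Exec k k' P a a' T) (h' : Exec k' k'' Q a' a'' T') :
    Exec k k'' (.seq P Q) a a'' (T + T') := by
  intro s hs
  obtain ⟨s1, t1, r1, b1, g1⟩ := h s hs
  obtain ⟨s2, t2, r2, b2, g2⟩ := h' s1 g1
  exact ⟨s2, t1 + t2, .seq r1 r2, Nat.add_le_add b1 b2, g2⟩

theorem Exec.post {k k' : ℕ} {P : RamProgram} {a a' a'' : RamState} {T : ℕ}
    (h : Exec k k' P a a' T) (ha : Agree k' a'' a') : Exec k k' P a a'' T := by
  intro s hs
  obtain ⟨s', t, h1, h2, h3⟩ := h s hs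
  exact ⟨s', t, h1, h2, ha.trans h3⟩

/-- For `P` the registers from `k` on are scratch, so values left there by an earlier computation
may be ignored. -/
theorem Exec.pre {k k' l : ℕ} {P : RamProgram} {a a' b : RamState} {T : ℕ}
    (h : Exec k k' P a a' T) (hk : k ≤ l) (ha : Agree k a b) : Exec l k' P b a' T :=
  fun s hs => h s (ha.trans (hs.mono hk))

/-- The registers that a test reads are below `k`. -/
def RamTest.Below (k : ℕ) : RamTest → Prop
  | .eq r r' | .ne r r' | .lt r r' | .le r r' => r < k ∧ r' < k

theorem RamTest.holds_iff {k : ℕ} {c : RamTest} (hc : c.Below k) {a s : RamState}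
    (h : Agree k a s) : c.Holds s ↔ c.Holds a := by
  cases c <;> simp only [RamTest.Holds, h.1 _ hc.1, h.1 _ hc.2]

theorem Exec.branch {k k' : ℕ} {P Q : RamProgram} {c : RamTest} {a a' : RamState} {T : ℕ}
    (hc : c.Below k) (hP : c.Holds a → Exec k k' P a a' T)
    (hQ : ¬ c.Holds a → Exec k k' Q a a' T) :
    Exec k k' (.branch c P Q) a a' (1 + T) := by
  intro s hs
  by_cases h : c.Holds a
  · obtain ⟨s', t, r, b, g⟩ := hP h s hs
    exact ⟨s', 1 + t, .branch_true ((RamTest.holds_iff hc hs).2 h) r, by omega, g⟩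
  · obtain ⟨s', t, r, b, g⟩ := hQ h s hs
    exact ⟨s', 1 + t, .branch_false (fun h' => h ((RamTest.holds_iff hc hs).1 h')) r, by omega, g⟩

theorem Exec.loop {k : ℕ} {P : RamProgram} {c : RamTest} (hc : c.Below k) (T : ℕ) :
    ∀ (N : ℕ) (x : ℕ → RamState),
      (∀ i, i < N → c.Holds (x i) ∧ Exec k k P (x i) (x (i + 1)) T) → ¬ c.Holds (x N) →
      Exec k k (.loop c P) (x 0) (x N) (N * (T + 1) + 1) := by
  intro N
  induction N with
  | zero =>
    intro x _ h0 s hs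
    exact ⟨s, 1, .loop_false (fun h' => h0 ((RamTest.holds_iff hc hs).1 h')), by omega, hs⟩
  | succ N ih =>
    intro x hx h0 s hs
    obtain ⟨h1, h2⟩ := hx 0 (by omega)
    obtain ⟨s1, t1, r1, b1, g1⟩ := h2 s hs
    obtain ⟨s2, t2, r2, b2, g2⟩ := ih (fun i => x (i + 1)) (fun i hi => hx (i + 1) (by omega)) h0
      s1 g1
    refine ⟨s2, 1 + t1 + t2, .loop_true ((RamTest.holds_iff hc hs).2 h1) r1 r2, ?_, g2⟩
    rw [Nat.add_mul]
    omega

/-! ### Functions computable in polynomial time -/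

/-- The number of registers that hold the global variables. -/
def numGlobals : ℕ := 8

/-- A context presents the elements of `A` to the machine: `base a` is the configuration of the
global variables, and `rep a` extends it by the local variables in the registers below `depth`. -/
class Ctx (A : Type) where
  depth : ℕ
  rep : A → RamState
  base : A → RamState
  le_depth : numGlobals ≤ depth
  agree : ∀ a, Agree numGlobals (base a) (rep a)

instance : Ctx RamState where
  depth := numGlobals
  rep := id
  base := id
  le_depth := le_rfl
  agree := Agree.refl _

/-- A new local variable occupies the first free register, so variables behave like de Bruijn
indices; `Comp.v0`, `Comp.v1`, `Comp.v2` read the innermost ones. -/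
instance {A : Type} [Ctx A] : Ctx (A × ℕ) where
  depth := Ctx.depth A + 1
  rep x := (Ctx.rep x.1).setReg (Ctx.depth A) x.2
  base x := Ctx.base x.1
  le_depth := Ctx.le_depth.trans (Nat.le_succ _)
  agree x := (Ctx.agree x.1).setReg_right Ctx.le_depth _

open Ctx

/-- The number of vertices, which bounds all loops. -/
def size {A : Type} [Ctx A] (a : A) : ℕ := (base a).reg 0

theorem rep_reg_zero {A : Type} [Ctx A] (a : A) : (rep a).reg 0 = size a :=
  (agree a).1 0 (by decide)

/-- `f` is computed by a program, in time polynomial in the size. -/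
def Comp {A : Type} [Ctx A] (f : A → ℕ) : Prop :=
  ∃ (P : RamProgram) (q : Polynomial ℕ), ∀ a : A,
    Exec (depth A) (depth A + 1) P (rep a) ((rep a).setReg (depth A) (f a)) (q.eval (size a))

open Classical in
/-- The predicate `p` is decided by a program, in time polynomial in the size. -/
def CompP {A : Type} [Ctx A] (p : A → Prop) : Prop :=
  Comp fun a => if p a then 1 else 0

section
variable {A : Type} [Ctx A]

theorem Comp.congr {f g : A → ℕ} (hf : Comp f) (h : ∀ a, f a = g a) : Comp g := by
  rwa [← funext h]

theorem CompP.congr {p p' : A → Prop} (hp : CompP p) (h : ∀ a, p a ↔ p' a) : CompP p' := by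
  rwa [← funext fun a => propext (h a)]

theorem Exec.const {k : ℕ} (a : RamState) (v : ℕ) :
    Exec k (k + 1) (.const k v) a (a.setReg k v) 1 :=
  fun s hs => ⟨_, 1, .const s k v, le_rfl, hs.setReg_succ v⟩

theorem Exec.copyTop {k r : ℕ} (hr : r < k) (a : RamState) :
    Exec k (k + 1) (.copy k r) a (a.setReg k (a.reg r)) 1 := by
  intro s hs
  refine ⟨_, 1, .copy s k r, le_rfl, ?_⟩
  rw [hs.1 r hr]
  exact hs.setReg_succ _

theorem Exec.copy {k r r' : ℕ} (hr : r < k) (a : RamState) :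
    Exec k k (.copy r' r) a (a.setReg r' (a.reg r)) 1 := by
  intro s hs
  refine ⟨_, 1, .copy s r' r, le_rfl, ?_⟩
  rw [hs.1 r hr]
  exact hs.setReg _ _

theorem Exec.inc {k r : ℕ} (hr : r < k) (a : RamState) :
    Exec k k (.inc r) a (a.setReg r (a.reg r + 1)) 1 := by
  intro s hs
  refine ⟨_, 1, .inc s r, le_rfl, ?_⟩
  rw [hs.1 r hr]
  exact hs.setReg _ _

theorem Exec.dec {k r : ℕ} (hr : r < k) (a : RamState) :
    Exec k k (.dec r) a (a.setReg r (a.reg r - 1)) 1 := by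
  intro s hs
  refine ⟨_, 1, .dec s r, le_rfl, ?_⟩
  rw [hs.1 r hr]
  exact hs.setReg _ _

theorem Exec.load {k r b r' : ℕ} (hr : r' < k) (a : RamState) :
    Exec k k (.load r b r') a (a.setReg r (a.mem b (a.reg r'))) 1 := by
  intro s hs
  refine ⟨_, 1, .load s r b r', le_rfl, ?_⟩
  rw [hs.1 r' hr, hs.2]
  exact hs.setReg _ _

theorem Exec.store {k r b r' : ℕ} (hr : r < k) (hr' : r' < k) (a : RamState) :
    Exec k k (.store b r' r) a (a.setMem b (a.reg r') (a.reg r)) 1 := by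
  intro s hs
  refine ⟨_, 1, .store s b r' r, le_rfl, ?_⟩
  rw [hs.1 r' hr', hs.1 r hr]
  exact hs.setMem _ _ _

@[simp] theorem RamState.setReg_reg_self (s : RamState) (r v : ℕ) : (s.setReg r v).reg r = v := by
  simp [RamState.setReg]

theorem RamState.setReg_reg_of_ne (s : RamState) {r j : ℕ} (h : j ≠ r) (v : ℕ) :
    (s.setReg r v).reg j = s.reg j := by
  simp [RamState.setReg, Function.update_of_ne h]

@[simp] theorem RamState.setReg_mem (s : RamState) (r v : ℕ) : (s.setReg r v).mem = s.mem := rfl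

@[simp] theorem RamState.setReg_setReg (s : RamState) (r v v' : ℕ) :
    (s.setReg r v).setReg r v' = s.setReg r v' := by
  simp [RamState.setReg]

@[simp] theorem RamState.setMem_reg (s : RamState) (b i v : ℕ) : (s.setMem b i v).reg = s.reg := rfl

theorem RamState.setReg_comm (s : RamState) {r r' : ℕ} (h : r ≠ r') (v v' : ℕ) :
    (s.setReg r v).setReg r' v' = (s.setReg r' v').setReg r v := by
  simp [RamState.setReg, Function.update_comm h]

theorem Comp.const (v : ℕ) : Comp fun _ : A => v :=
  ⟨.const (depth A) v, 1, fun a => by simpa using Exec.const (rep a) v⟩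

/-- Every register that presents a variable can be read. -/
theorem Comp.of_reg {f : A → ℕ} {r : ℕ} (hr : r < depth A) (h : ∀ a, (rep a).reg r = f a) :
    Comp f :=
  ⟨.copy (depth A) r, 1, fun a => by
    have := Exec.copyTop hr (rep a)
    rw [h] at this
    simpa using this⟩

theorem Comp.global (r : ℕ) (hr : r < numGlobals) : Comp fun a : A => (base a).reg r :=
  .of_reg (hr.trans_le le_depth) fun a => (agree a).1 r hr

theorem Comp.sizeFn : Comp fun a : A => size a := .global 0 (by decide)

theorem Comp.v0 : Comp fun x : A × ℕ => x.2 :=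
  .of_reg (r := depth A) (Nat.lt_succ_self _) fun x => by simp [rep]

theorem Comp.v1 : Comp fun x : (A × ℕ) × ℕ => x.1.2 :=
  .of_reg (r := depth A) (show _ < depth A + 1 + 1 by omega) fun x => by
    simp [rep, depth, RamState.setReg]

theorem Agree.self_setReg {k r : ℕ} (a : RamState) (hr : k ≤ r) (v : ℕ) :
    Agree k a (a.setReg r v) :=
  (Agree.refl k a).setReg_right hr v

theorem Comp.v2 : Comp fun x : ((A × ℕ) × ℕ) × ℕ => x.1.1.2 :=
  .of_reg (r := depth A) (show _ < depth A + 1 + 1 + 1 by omega) fun x => by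
    simp only [rep, depth]
    rw [RamState.setReg_reg_of_ne _ (by omega), RamState.setReg_reg_of_ne _ (by omega),
      RamState.setReg_reg_self]

theorem Comp.succ {f : A → ℕ} (hf : Comp f) : Comp fun a => f a + 1 := by
  obtain ⟨P, q, h⟩ := hf
  refine ⟨.seq P (.inc (depth A)), q + 1, fun a => ?_⟩
  have := (h a).seq (Exec.inc (Nat.lt_succ_self _) _)
  simpa using this

theorem Comp.pred {f : A → ℕ} (hf : Comp f) : Comp fun a => f a - 1 := by
  obtain ⟨P, q, h⟩ := hf
  refine ⟨.seq P (.dec (depth A)), q + 1, fun a => ?_⟩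
  have := (h a).seq (Exec.dec (Nat.lt_succ_self _) _)
  simpa using this

theorem Comp.mem (b : ℕ) {f : A → ℕ} (hf : Comp f) : Comp fun a => (base a).mem b (f a) := by
  obtain ⟨P, q, h⟩ := hf
  refine ⟨.seq P (.load (depth A) b (depth A)), q + 1, fun a => ?_⟩
  have := (h a).seq (Exec.load (r := depth A) (b := b) (Nat.lt_succ_self _) _)
  simpa [(agree a).2] using this

/-- Bind the value of `v` to a new local variable. -/
theorem Comp.bind {v : A → ℕ} {g : A → ℕ → ℕ} (hv : Comp v)
    (hg : Comp fun x : A × ℕ => g x.1 x.2) : Comp fun a => g a (v a) := by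
  obtain ⟨P, q, h⟩ := hv
  obtain ⟨Q, q', h'⟩ := hg
  refine ⟨.seq (.seq P Q) (.copy (depth A) (depth A + 1)), q + q' + 1, fun a => ?_⟩
  have h3 := ((h a).seq (h' (a, v a))).seq (Exec.copy (r' := depth A) (Nat.lt_succ_self _) _)
  refine ((h3.mono ?_).weaken (k'' := depth A + 1) (Nat.le_succ _)).post ?_
  · simp only [Polynomial.eval_add, Polynomial.eval_one]; exact le_rfl
  · simp only [rep, depth, RamState.setReg_reg_self]
    rw [RamState.setReg_comm _ (by omega), RamState.setReg_setReg]
    exact Agree.self_setReg _ le_rfl _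

/-- All registers written by the program are below `P.bound`. -/
def RamProgram.bound : RamProgram → ℕ
  | .skip => 0
  | .const r _ | .copy r _ | .inc r | .dec r | .load r _ _ => r + 1
  | .store _ _ _ => 0
  | .seq P Q | .branch _ P Q => max P.bound Q.bound
  | .loop _ P => P.bound

theorem RamProgram.Run.reg_eq {P : RamProgram} {s s' : RamState} {t : ℕ} (h : P.Run s s' t)
    {r : ℕ} (hr : P.bound ≤ r) : s'.reg r = s.reg r := by
  induction h with
  | skip | store => rfl
  | const | copy | inc | dec | load =>
    simp only [RamProgram.bound] at hr
    rw [RamState.setReg_reg_of_ne _ (by omega)]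
  | seq _ _ ih₁ ih₂ =>
    simp only [RamProgram.bound] at hr
    rw [ih₂ (by omega), ih₁ (by omega)]
  | branch_true _ _ ih | branch_false _ _ ih =>
    simp only [RamProgram.bound] at hr
    exact ih (by omega)
  | loop_true _ _ _ ih₁ ih₂ => rw [ih₂ hr, ih₁ hr]
  | loop_false => rfl

/-- The program for `f` writes its result to the register that now holds the additional variable.
That variable is parked in a register `R` which the program never writes, and restored afterwards.
-/
theorem Comp.weak {f : A → ℕ} (hf : Comp f) : Comp fun x : A × ℕ => f x.1 := by
  obtain ⟨P, q, h⟩ := hf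
  set d := depth A with hd
  set R := max P.bound (d + 2) with hR
  refine ⟨.seq (.copy R d) (.seq P (.seq (.copy (d + 1) d) (.copy d R))), q + 3, ?_⟩
  rintro ⟨a, i⟩ s hs
  obtain ⟨hs', hi⟩ := Agree.of_succ (show Agree (d + 1) ((rep a).setReg d i) s from hs)
  obtain ⟨s', t, r, b, g⟩ := h a _ (hs'.setReg_right (r := R) (by omega) (s.reg d))
  obtain ⟨g', hv⟩ := g.of_succ
  have hRi : s'.reg R = i := by
    rw [r.reg_eq (le_max_left _ _), RamState.setReg_reg_self, hi]
  refine ⟨_, _, .seq (.copy s R d) (.seq r (.seq (.copy _ (d + 1) d) (.copy _ d R))), ?_, ?_⟩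
  · have : size (a, i) = size a := rfl
    simp only [Polynomial.eval_add, Polynomial.eval_ofNat, this]; omega
  · rw [RamState.setReg_reg_of_ne _ (show R ≠ d + 1 by omega), hRi, hv]
    rw [RamState.setReg_comm _ (show d + 1 ≠ d by omega)]
    exact (g'.setReg_succ i).setReg_succ (f a)

/-- Operations on the top two variables yield operations on all computable functions. -/
theorem Comp.bind₂ {f g : A → ℕ} {F : ℕ → ℕ → ℕ}
    (hF : Comp fun x : (A × ℕ) × ℕ => F x.1.2 x.2) (hf : Comp f) (hg : Comp g) :
    Comp fun a => F (f a) (g a) :=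
  .bind (g := fun a x => F x (g a)) hf
    (.bind (v := fun x : A × ℕ => g x.1) (g := fun x y => F x.2 y) hg.weak hF)

/-- A test of the machine on two variables, with answer `1` or `0`. -/
theorem Comp.ofTest (c : ℕ → ℕ → RamTest) (hc : ∀ {k r r'}, r < k → r' < k → (c r r').Below k)
    (p : ℕ → ℕ → Prop) (hp : ∀ s r r', (c r r').Holds s ↔ p (s.reg r) (s.reg r'))
    {f g : A → ℕ} (hf : Comp f) (hg : Comp g) : CompP fun a => p (f a) (g a) := by
  classical
  refine Comp.bind₂ (F := fun x y => if p x y then 1 else 0) ?_ hf hg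
  refine ⟨.branch (c (depth A) (depth A + 1)) (.const (depth A + 2) 1) (.const (depth A + 2) 0), 2,
    fun x => ?_⟩
  have hx : ∀ s : RamState, s = rep x → ((c (depth A) (depth A + 1)).Holds s ↔ p x.1.2 x.2) := by
    rintro s rfl
    rw [hp]
    simp [rep, depth, RamState.setReg]
  refine (Exec.branch (hc (by simp only [depth]; omega) (by simp [depth])) (fun h => ?_)
    (fun h => ?_)).mono (T := 1 + 1) (by simp)
  · simp only [if_pos ((hx _ rfl).1 h)]
    exact Exec.const _ _
  · simp only [if_neg (fun h' => h ((hx _ rfl).2 h'))]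
    exact Exec.const _ _

theorem CompP.lt {f g : A → ℕ} (hf : Comp f) (hg : Comp g) : CompP fun a => f a < g a :=
  Comp.ofTest .lt (fun h h' => ⟨h, h'⟩) (· < ·) (fun _ _ _ => Iff.rfl) hf hg

theorem CompP.le {f g : A → ℕ} (hf : Comp f) (hg : Comp g) : CompP fun a => f a ≤ g a :=
  Comp.ofTest .le (fun h h' => ⟨h, h'⟩) (· ≤ ·) (fun _ _ _ => Iff.rfl) hf hg

theorem CompP.eq {f g : A → ℕ} (hf : Comp f) (hg : Comp g) : CompP fun a => f a = g a :=
  Comp.ofTest .eq (fun h h' => ⟨h, h'⟩) (· = ·) (fun _ _ _ => Iff.rfl) hf hg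

theorem Comp.ite {p : A → Prop} [DecidablePred p] {f g : A → ℕ} (hp : CompP p) (hf : Comp f) (hg : Comp g) :
    Comp fun a => if p a then f a else g a := by
  obtain ⟨P, q, h⟩ := hp
  obtain ⟨P₁, q₁, h₁⟩ := hf
  obtain ⟨P₂, q₂, h₂⟩ := hg
  set d := depth A with hd
  -- The answer of `P` is compared with `0`, so equality selects the negative case `P₂`.
  refine ⟨.seq (.seq P (.const (d + 1) 0)) (.branch (.eq d (d + 1)) P₂ P₁), q + 1 + (1 + (q₁ + q₂)),
    fun a => ?_⟩
  have h3 := (h a).seq (Exec.const _ 0)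
  refine ((h3.seq (Exec.branch (c := .eq d (d + 1)) (T := q₁.eval (size a) + q₂.eval (size a))
    ⟨by omega, by omega⟩ (fun hc => ?_) (fun hc => ?_))).mono ?_)
  · have hn : ¬ p a := by
      intro hpa
      simp [RamTest.Holds, RamState.setReg, hpa] at hc
    simp only [if_neg hn]
    refine ((h₂ a).mono (Nat.le_add_left _ _)).pre (by omega) ?_
    exact (Agree.self_setReg _ le_rfl _).trans (Agree.self_setReg _ (by omega) _)
  · have hn : p a := by
      by_contra hpa
      simp [RamTest.Holds, RamState.setReg, hpa] at hc
    simp only [if_pos hn]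
    refine ((h₁ a).mono (Nat.le_add_right _ _)).pre (by omega) ?_
    exact (Agree.self_setReg _ le_rfl _).trans (Agree.self_setReg _ (by omega) _)
  · simp

/-- Bounded recursion. -/
theorem Comp.fold {f : A → ℕ} {g : A → ℕ → ℕ → ℕ} (hf : Comp f)
    (hg : Comp fun x : (A × ℕ) × ℕ => g x.1.1 x.1.2 x.2) :
    Comp fun a => Nat.rec (f a) (fun i acc => g a i acc) (size a) := by
  obtain ⟨P, q, h⟩ := hf
  obtain ⟨Q, q', h'⟩ := hg
  set d := depth A with hd
  -- Register `d` is the counter and `d + 1` the accumulator; `Q` leaves the next accumulator in `d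
  -- + 2`.
  refine ⟨.seq (.seq (.seq (.seq P (.copy (d + 1) d)) (.const d 0))
    (.loop (.lt d 0) (.seq (.seq Q (.copy (d + 1) (d + 2))) (.inc d)))) (.copy d (d + 1)),
    q + 1 + 1 + (.X * (q' + 1 + 1 + 1) + 1) + 1, fun a => ?_⟩
  let acc : ℕ → ℕ := fun i => Nat.rec (f a) (fun i acc => g a i acc) i
  let x : ℕ → RamState := fun i => rep (((a, i), acc i) : (A × ℕ) × ℕ)
  have hx : ∀ i, x i = ((rep a).setReg d i).setReg (d + 1) (acc i) := fun _ => rfl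
  have hd0 : 0 < d := lt_of_lt_of_le (by decide) (le_depth (A := A))
  have hx0 : ∀ i, (x i).reg 0 = size a ∧ (x i).reg d = i := by
    intro i
    rw [hx, RamState.setReg_reg_of_ne _ (by omega), RamState.setReg_reg_of_ne _ (by omega),
      RamState.setReg_reg_of_ne _ (by omega)]
    exact ⟨rep_reg_zero a, by simp⟩
  have h1 : Exec d (d + 2) (.seq (.seq P (.copy (d + 1) d)) (.const d 0)) (rep a) (x 0)
      (q.eval (size a) + 1 + 1) := by
    refine ((h a).seq (Exec.copyTop (Nat.lt_succ_self _) _)).seq (k'' := d + 2) ?_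
    intro s hs
    refine ⟨_, 1, .const s d 0, le_rfl, ?_⟩
    have := hs.setReg d 0
    rwa [RamState.setReg_comm _ (by omega), RamState.setReg_setReg, RamState.setReg_reg_self]
      at this
  have h2 : ∀ i, i < size a → (RamTest.lt d 0).Holds (x i) ∧
      Exec (d + 2) (d + 2) (.seq (.seq Q (.copy (d + 1) (d + 2))) (.inc d)) (x i) (x (i + 1))
        (q'.eval (size a) + 1 + 1) := by
    intro i hi
    refine ⟨by simpa only [RamTest.Holds, hx0] using hi, ?_⟩
    have h3 := ((h' ((a, i), acc i)).seq (Exec.copy (r' := d + 1) (Nat.lt_succ_self _) _)).seq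
      (Exec.inc (r := d) (by simp only [depth]; omega) _)
    refine (h3.weaken (k'' := d + 2) (by simp only [depth]; omega)).post ?_
    have e1 : depth ((A × ℕ) × ℕ) = d + 2 := rfl
    rw [e1, RamState.setReg_reg_self, RamState.setReg_comm _ (show d + 2 ≠ d + 1 by omega),
      RamState.setReg_reg_of_ne _ (show d ≠ d + 2 by omega),
      RamState.setReg_reg_of_ne _ (show d ≠ d + 1 by omega), (hx0 i).2,
      RamState.setReg_comm _ (show d + 2 ≠ d by omega)]
    have e2 : rep (((a, i), acc i) : (A × ℕ) × ℕ) = ((rep a).setReg d i).setReg (d + 1) (acc i) :=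
      rfl
    rw [e2, RamState.setReg_setReg, RamState.setReg_comm _ (show d + 1 ≠ d by omega),
      RamState.setReg_setReg, hx]
    exact Agree.self_setReg _ le_rfl _
  have h4 := Exec.loop (k := d + 2) (c := .lt d 0) ⟨by omega, by omega⟩ _ (size a) x h2
    (by simp only [RamTest.Holds, hx0]; omega)
  have h5 := (h1.seq h4).seq (Exec.copy (r := d + 1) (r' := d) (by omega) _)
  refine ((h5.mono ?_).weaken (k'' := d + 1) (by omega)).post ?_
  · simp
  · rw [hx, RamState.setReg_reg_self, RamState.setReg_comm _ (show d + 1 ≠ d by omega),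
      RamState.setReg_setReg]
    exact Agree.self_setReg _ le_rfl _

end

section
variable {A : Type} [Ctx A]

theorem CompP.and {p p' : A → Prop} (hp : CompP p) (hp' : CompP p') :
    CompP fun a => p a ∧ p' a := by
  classical
  refine (Comp.ite hp hp' (.const 0)).congr fun a => ?_
  by_cases h : p a <;> simp [h]

theorem CompP.not {p : A → Prop} (hp : CompP p) : CompP fun a => ¬ p a := by
  classical
  refine (Comp.ite hp (.const 0) (.const 1)).congr fun a => ?_
  by_cases h : p a <;> simp [h]

theorem CompP.or {p p' : A → Prop} (hp : CompP p) (hp' : CompP p') :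
    CompP fun a => p a ∨ p' a :=
  (hp.not.and hp'.not).not.congr fun a => by tauto

theorem CompP.imp {p p' : A → Prop} (hp : CompP p) (hp' : CompP p') :
    CompP fun a => p a → p' a :=
  (hp.and hp'.not).not.congr fun a => by tauto

theorem CompP.ne {f g : A → ℕ} (hf : Comp f) (hg : Comp g) : CompP fun a => f a ≠ g a :=
  (CompP.eq hf hg).not

theorem CompP.ex {p : A → ℕ → Prop} (hp : CompP fun x : A × ℕ => p x.1 x.2) :
    CompP fun a => ∃ i < size a, p a i := by
  classical
  unfold CompP
  have h : CompP fun x : (A × ℕ) × ℕ => p x.1.1 x.1.2 :=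
    Comp.weak (f := fun x : A × ℕ => if p x.1 x.2 then 1 else 0) hp
  refine (Comp.fold (g := fun a i acc => if p a i then 1 else acc) (.const 0)
    (Comp.ite h (.const 1) .v0)).congr fun a => ?_
  suffices ∀ k, (Nat.rec 0 (fun i acc => if p a i then 1 else acc) k : ℕ)
      = if ∃ i < k, p a i then 1 else 0 from
    (this _).trans (by congr)
  intro n
  induction n with
  | zero => simp
  | succ n ih =>
    simp only [ih]
    by_cases h : p a n
    · rw [if_pos h, if_pos ⟨n, Nat.lt_succ_self n, h⟩]
    · rw [if_neg h]
      refine if_congr ⟨fun ⟨i, hi, hp⟩ => ⟨i, by omega, hp⟩, ?_⟩ rfl rfl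
      rintro ⟨i, hi, hp⟩
      rcases Nat.lt_succ_iff_lt_or_eq.1 hi with hi | rfl
      · exact ⟨i, hi, hp⟩
      · exact absurd hp h

theorem CompP.all {p : A → ℕ → Prop} (hp : CompP fun x : A × ℕ => p x.1 x.2) :
    CompP fun a => ∀ i < size a, p a i :=
  (CompP.ex (p := fun a i => ¬ p a i) hp.not).not.congr fun a => by push Not; rfl

/-- The number of `i < n` with `p i`. -/
noncomputable def numBelow (n : ℕ) (p : ℕ → Prop) : ℕ :=
  open Classical in Nat.count p n

theorem numBelow_eq (n : ℕ) (p : ℕ → Prop) [DecidablePred p] :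
    numBelow n p = ((Finset.range n).filter p).card := by
  rw [numBelow, Nat.count_eq_card_filter_range]
  congr!

theorem Comp.numBelow {p : A → ℕ → Prop} (hp : CompP fun x : A × ℕ => p x.1 x.2) :
    Comp fun a => numBelow (size a) (p a) := by
  classical
  have h : CompP fun x : (A × ℕ) × ℕ => p x.1.1 x.1.2 :=
    Comp.weak (f := fun x : A × ℕ => if p x.1 x.2 then 1 else 0) hp
  refine (Comp.fold (g := fun a i acc => if p a i then acc + 1 else acc) (.const 0)
    (Comp.ite h Comp.v0.succ .v0)).congr fun a => ?_
  unfold _root_.numBelow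
  induction size a with
  | zero => simp
  | succ n ih =>
    simp only [ih, Nat.count_succ]
    split <;> rfl

/-- The least `i < n` with `p i`, or `n` if there is none. -/
noncomputable def leastBelow (n : ℕ) (p : ℕ → Prop) : ℕ :=
  sInf {i | i = n ∨ p i}

theorem leastBelow_le (n : ℕ) (p : ℕ → Prop) : leastBelow n p ≤ n :=
  Nat.sInf_le (Or.inl rfl)

theorem leastBelow_spec {n : ℕ} {p : ℕ → Prop} (h : leastBelow n p < n) : p (leastBelow n p) := by
  have : leastBelow n p = n ∨ p (leastBelow n p) :=
    Nat.sInf_mem (s := {i | i = n ∨ p i}) ⟨n, Or.inl rfl⟩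
  exact this.resolve_left h.ne

theorem leastBelow_le_of {n i : ℕ} {p : ℕ → Prop} (h : p i) : leastBelow n p ≤ i :=
  Nat.sInf_le (Or.inr h)

theorem leastBelow_lt_iff {n : ℕ} {p : ℕ → Prop} : leastBelow n p < n ↔ ∃ i < n, p i :=
  ⟨fun h => ⟨_, h, leastBelow_spec h⟩, fun ⟨_, hi, hp⟩ => (leastBelow_le_of hp).trans_lt hi⟩

theorem Comp.leastBelow {p : A → ℕ → Prop} (hp : CompP fun x : A × ℕ => p x.1 x.2) :
    Comp fun a => leastBelow (size a) (p a) := by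
  classical
  have h : CompP fun x : (A × ℕ) × ℕ => p x.1.1 x.1.2 :=
    Comp.weak (f := fun x : A × ℕ => if p x.1 x.2 then 1 else 0) hp
  refine (Comp.fold (g := fun a i acc => if acc = size a ∧ p a i then i else acc) .sizeFn
    (Comp.ite ((CompP.eq .v0 .sizeFn).and h) .v1 .v0)).congr fun a => ?_
  suffices ∀ k ≤ size a,
      (Nat.rec (size a) (fun i acc => if acc = size a ∧ p a i then i else acc) k : ℕ)
        = if _root_.leastBelow (size a) (p a) < k then _root_.leastBelow (size a) (p a)
          else size a by
    rw [this _ le_rfl]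
    have := leastBelow_le (size a) (p a)
    split <;> omega
  intro k
  induction k with
  | zero => simp
  | succ m ih =>
    intro hm
    simp only [ih (by omega)]
    have h0 : p a m → _root_.leastBelow (size a) (p a) ≤ m := fun h => leastBelow_le_of h
    by_cases h1 : _root_.leastBelow (size a) (p a) < m
    · rw [if_pos h1, if_neg (by omega), if_pos (by omega)]
    · rw [if_neg h1]
      by_cases h2 : p a m
      · have := h0 h2
        rw [if_pos ⟨rfl, h2⟩, if_pos (by omega)]
        omega
      · rw [if_neg (fun h => h2 h.2), if_neg]
        intro h3
        have h4 : _root_.leastBelow (size a) (p a) = m := by omega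
        have h5 := leastBelow_spec (n := size a) (p := p a) (by omega)
        exact h2 (h4 ▸ h5)

/-- All loops run `size a` times, so repeated successors add `g a` only up to the size. Where it
matters, the second summand is at most the size and the minimum disappears. -/
theorem Comp.min_add {f g : A → ℕ} (hf : Comp f) (hg : Comp g) :
    Comp fun a => f a + min (g a) (size a) := by
  classical
  refine (Comp.fold (g := fun a i acc => if i < g a then acc + 1 else acc) hf
    (Comp.ite (.lt .v1 hg.weak.weak) Comp.v0.succ .v0)).congr fun a => ?_
  induction size a with
  | zero => simp
  | succ n ih => simp only [ih]; split <;> omega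

theorem Comp.sub_min {f g : A → ℕ} (hf : Comp f) (hg : Comp g) :
    Comp fun a => f a - min (g a) (size a) := by
  classical
  refine (Comp.fold (g := fun a i acc => if i < g a then acc - 1 else acc) hf
    (Comp.ite (.lt .v1 hg.weak.weak) Comp.v0.pred .v0)).congr fun a => ?_
  induction size a with
  | zero => simp
  | succ n ih => simp only [ih]; split <;> omega

theorem Comp.mul_size {f : A → ℕ} (hf : Comp f) : Comp fun a => min (f a) (size a) * size a := by
  classical
  refine (Comp.fold (g := fun a i acc => if i < f a then acc + min (size a) (size a) else acc)
    (.const 0) (Comp.ite (.lt .v1 hf.weak.weak) (Comp.min_add .v0 (Comp.sizeFn)) .v0)).congr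
    fun a => ?_
  suffices ∀ k, (Nat.rec 0 (fun i acc => if i < f a then acc + min (size a) (size a) else acc) k : ℕ)
      = min (f a) k * size a from this _
  intro k
  induction k with
  | zero => simp
  | succ n ih =>
    simp only [ih]; split
    · rw [min_self, min_eq_right (by omega), min_eq_right (by omega), Nat.succ_mul]
    · rw [min_eq_left (by omega), min_eq_left (by omega)]

end

/-! ### The coloring built from a modulator and a guess. -/

/-- A graph with a partial coloring, a list `S` of `b` vertices to be deleted, and a word `w` that
encodes a guess. Vertices are the numbers below `n`; a color `0` means that there is no color. -/
structure Data where
  n : ℕ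
  adj : ℕ → ℕ → Prop
  p : ℕ → ℕ
  b : ℕ
  S : ℕ → ℕ
  w : ℕ → ℕ

namespace Data
variable (D : Data)

/-- `v` is one of the first `j` vertices of the list `S`. -/
def Del (j v : ℕ) : Prop := ∃ i < D.n, i < j ∧ D.S i = v

/-- `x`, `y`, `z` is an induced path that avoids the first `j` vertices of the list `S`. -/
def IsP3 (j x y z : ℕ) : Prop :=
  D.adj x y ∧ D.adj y z ∧ x ≠ z ∧ ¬ D.adj x z ∧ ¬ D.Del j x ∧ ¬ D.Del j y ∧ ¬ D.Del j z

/-- Together with `p3y` and `p3z` this is the lexicographically first path. If none is left, and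
adjacency is confined to numbers below `n`, all three are `n`, so that surplus picks delete nothing.
-/
noncomputable def p3x (j : ℕ) : ℕ := leastBelow D.n fun x => ∃ y < D.n, ∃ z < D.n, D.IsP3 j x y z

noncomputable def p3y (j : ℕ) : ℕ := leastBelow D.n fun y => ∃ z < D.n, D.IsP3 j (D.p3x j) y z

noncomputable def p3z (j : ℕ) : ℕ := leastBelow D.n fun z => D.IsP3 j (D.p3x j) (D.p3y j) z

/-- The vertex of the first induced path on three vertices that is selected by the word `w`. -/
noncomputable def pick (j : ℕ) : ℕ :=
  if D.w j = 0 then D.p3x j else if D.w j = 1 then D.p3y j else D.p3z j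

/-- No induced path on three vertices is left after the deletion of the first `j` vertices of
the list `S`. -/
def P3Free (j : ℕ) : Prop := ¬ ∃ x < D.n, ∃ y < D.n, ∃ z < D.n, D.IsP3 j x y z

/-- The guessed color class of the `j`-th deleted vertex. -/
def cls (j : ℕ) : ℕ := if D.w j < D.b then D.w j else D.w j - min D.b D.n

/-- The vertex `v` is forced into the class `i`. -/
def Src (i v : ℕ) : Prop :=
  ∃ j < D.n, j < D.b ∧ D.cls j = i ∧ (D.S j = v ∨ (D.w j < D.b ∧ D.adj (D.S j) v))

/-- The class that `v` is forced into, or `n`. -/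
noncomputable def lab (v : ℕ) : ℕ := leastBelow D.n fun i => D.Src i v

/-- `u` and `v` lie in the same clique of the cluster graph. -/
def Rel (u v : ℕ) : Prop := ¬ D.Del D.b u ∧ ¬ D.Del D.b v ∧ (u = v ∨ D.adj u v)

/-- The vertex `u` can be happy only if it has the color of the class `i`. -/
def Touch (u i : ℕ) : Prop :=
  (∃ j < D.n, j < D.b ∧ D.cls j = i ∧ D.adj u (D.S j)) ∨ ∃ y < D.n, D.Rel u y ∧ D.lab y = i

/-- `u` touches no class other than `i`. -/
def TouchOnly (u i : ℕ) : Prop := ∀ i' < D.n, D.Touch u i' → i' = i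

/-- The clique of `u` has a precolored vertex. -/
def Pre (u : ℕ) : Prop := ∃ y < D.n, D.Rel u y ∧ D.p y ≠ 0

/-- `u` is in a precolored clique and touches the class `i` only. -/
def Dep (i u : ℕ) : Prop := ¬ D.Del D.b u ∧ D.Pre u ∧ D.Touch u i ∧ D.TouchOnly u i

/-- The number of vertices that become happy by giving the color `a` to the class `i`. -/
noncomputable def wt (i a : ℕ) : ℕ :=
  numBelow D.n fun u => D.Dep i u ∧ ∀ y < D.n, D.Rel u y → D.p y ≠ 0 → D.p y = a

/-- A precolored vertex that is forced into the class `i`, or `n`. -/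
noncomputable def fixer (i : ℕ) : ℕ := leastBelow D.n fun v => D.lab v = i ∧ D.p v ≠ 0

/-- A vertex whose precolor is the best choice for the class `i`, or `n`. -/
noncomputable def best (i : ℕ) : ℕ :=
  leastBelow D.n fun x => D.p x ≠ 0 ∧ ∀ x' < D.n, D.p x' ≠ 0 → D.wt i (D.p x') ≤ D.wt i (D.p x)

/-- The color of the class `i`. -/
noncomputable def clsCol (i : ℕ) : ℕ :=
  if D.fixer i < D.n then D.p (D.fixer i) else if D.best i < D.n then D.p (D.best i) else 1

/-- The number of vertices in the clique of `v` that touch no class other than `i`. -/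
noncomputable def cnt (v i : ℕ) : ℕ := numBelow D.n fun u => D.Rel v u ∧ D.TouchOnly u i

/-- The best class for the clique of `v`. -/
noncomputable def bestCls (v : ℕ) : ℕ :=
  leastBelow D.n fun i => ∀ i' < D.n, D.cnt v i' ≤ D.cnt v i

/-- The first precolored vertex in the clique of `v`, or `n`. -/
noncomputable def preVert (v : ℕ) : ℕ := leastBelow D.n fun y => D.Rel v y ∧ D.p y ≠ 0

/-- The coloring that is constructed from the guess. -/
noncomputable def col (v : ℕ) : ℕ :=
  if D.p v ≠ 0 then D.p v
  else if D.lab v < D.n then D.clsCol (D.lab v)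
  else if D.preVert v < D.n then D.p (D.preVert v)
  else D.clsCol (D.bestCls v)

/-- All neighbours of `u` have the color of `u`. -/
def Happy (c : ℕ → ℕ) (u : ℕ) : Prop := ∀ y < D.n, D.adj u y → c y = c u

/-- The colors are numbers from `1` to `l`, and at least `m` vertices are happy. -/
def Good (l : ℕ) (m : ℕ) : Prop :=
  (∀ v < D.n, 1 ≤ D.col v ∧ D.col v ≤ l) ∧ m ≤ numBelow D.n (D.Happy D.col)

end Data

/-- The data in the store of the machine. -/
def RamState.data (s : RamState) : Data where
  n := s.reg 0
  adj u v := u < s.reg 0 ∧ v < s.reg 0 ∧ s.mem 0 (u * s.reg 0 + v) = 1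
  p := s.mem 1
  b := s.reg 4
  S := s.mem 3
  w := s.mem 4

/-! ### Programs that compute the coloring. -/

section
variable {A : Type} [Ctx A]

/-- The data in the store of the machine. -/
def dat (a : A) : Data := (base a).data

theorem CompP.adj {u v : A → ℕ} (hu : Comp u) (hv : Comp v) :
    CompP fun a => (dat a).adj (u a) (v a) := by
  have h : CompP fun a => (u a < size a ∧ v a < size a) ∧
      (base a).mem 0 (min (u a) (size a) * size a + min (v a) (size a)) = 1 :=
    .and (.and (.lt hu .sizeFn) (.lt hv .sizeFn))
      (.eq (.mem 0 (.min_add (.mul_size hu) hv)) (.const 1))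
  refine h.congr fun a => ?_
  simp only [dat, RamState.data, and_assoc]
  refine and_congr_right fun h1 => and_congr_right fun h2 => ?_
  rw [min_eq_left h1.le, min_eq_left h2.le]
  rfl

theorem Comp.dataP {v : A → ℕ} (hv : Comp v) : Comp fun a => (dat a).p (v a) := .mem 1 hv

theorem Comp.dataS {v : A → ℕ} (hv : Comp v) : Comp fun a => (dat a).S (v a) := .mem 3 hv

theorem Comp.dataW {v : A → ℕ} (hv : Comp v) : Comp fun a => (dat a).w (v a) := .mem 4 hv

theorem Comp.dataB : Comp fun a : A => (dat a).b := .global 4 (by decide)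

theorem CompP.del {j v : A → ℕ} (hj : Comp j) (hv : Comp v) :
    CompP fun a => (dat a).Del (j a) (v a) :=
  .ex (p := fun a i => i < j a ∧ (dat a).S i = v a)
    (.and (.lt .v0 hj.weak) (.eq (.dataS .v0) hv.weak))

theorem CompP.isP3 {j x y z : A → ℕ} (hj : Comp j) (hx : Comp x) (hy : Comp y) (hz : Comp z) :
    CompP fun a => (dat a).IsP3 (j a) (x a) (y a) (z a) :=
  .and (.adj hx hy) (.and (.adj hy hz) (.and (.ne hx hz) (.and (.not (.adj hx hz))
    (.and (.not (.del hj hx)) (.and (.not (.del hj hy)) (.not (.del hj hz)))))))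

theorem Comp.p3x {j : A → ℕ} (hj : Comp j) : Comp fun a => (dat a).p3x (j a) :=
  .leastBelow (p := fun a x => ∃ y < (dat a).n, ∃ z < (dat a).n, (dat a).IsP3 (j a) x y z)
    (.ex (p := fun (a : A × ℕ) y => ∃ z < (dat a).n, (dat a).IsP3 (j a.1) a.2 y z)
      (.ex (p := fun (a : (A × ℕ) × ℕ) z => (dat a).IsP3 (j a.1.1) a.1.2 a.2 z)
        (.isP3 hj.weak.weak.weak .v2 .v1 .v0)))

theorem Comp.p3y {j : A → ℕ} (hj : Comp j) : Comp fun a => (dat a).p3y (j a) :=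
  .leastBelow (p := fun a y => ∃ z < (dat a).n, (dat a).IsP3 (j a) ((dat a).p3x (j a)) y z)
    (.ex (p := fun (a : A × ℕ) z => (dat a).IsP3 (j a.1) ((dat a).p3x (j a.1)) a.2 z)
      (.isP3 hj.weak.weak (Comp.p3x hj).weak.weak .v1 .v0))

theorem Comp.p3z {j : A → ℕ} (hj : Comp j) : Comp fun a => (dat a).p3z (j a) :=
  .leastBelow (p := fun a z => (dat a).IsP3 (j a) ((dat a).p3x (j a)) ((dat a).p3y (j a)) z)
    (.isP3 hj.weak (Comp.p3x hj).weak (Comp.p3y hj).weak .v0)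

theorem Comp.pick {j : A → ℕ} (hj : Comp j) : Comp fun a => (dat a).pick (j a) :=
  .ite (.eq (.dataW hj) (.const 0)) (.p3x hj) (.ite (.eq (.dataW hj) (.const 1)) (.p3y hj) (.p3z hj))

theorem CompP.p3Free {j : A → ℕ} (hj : Comp j) : CompP fun a => (dat a).P3Free (j a) :=
  .not (.ex (p := fun a x => ∃ y < (dat a).n, ∃ z < (dat a).n, (dat a).IsP3 (j a) x y z)
    (.ex (p := fun (a : A × ℕ) y => ∃ z < (dat a).n, (dat a).IsP3 (j a.1) a.2 y z)
      (.ex (p := fun (a : (A × ℕ) × ℕ) z => (dat a).IsP3 (j a.1.1) a.1.2 a.2 z)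
        (.isP3 hj.weak.weak.weak .v2 .v1 .v0))))

theorem Comp.cls {j : A → ℕ} (hj : Comp j) : Comp fun a => (dat a).cls (j a) :=
  .ite (.lt (.dataW hj) .dataB) (.dataW hj) (.sub_min (.dataW hj) .dataB)

theorem CompP.src {i v : A → ℕ} (hi : Comp i) (hv : Comp v) :
    CompP fun a => (dat a).Src (i a) (v a) :=
  .ex (p := fun a j => j < (dat a).b ∧ (dat a).cls j = i a ∧
      ((dat a).S j = v a ∨ ((dat a).w j < (dat a).b ∧ (dat a).adj ((dat a).S j) (v a))))
    (.and (.lt .v0 .dataB) (.and (.eq (.cls .v0) hi.weak) (.or (.eq (.dataS .v0) hv.weak)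
      (.and (.lt (.dataW .v0) .dataB) (.adj (.dataS .v0) hv.weak)))))

theorem Comp.lab {v : A → ℕ} (hv : Comp v) : Comp fun a => (dat a).lab (v a) :=
  .leastBelow (p := fun a i => (dat a).Src i (v a)) (.src .v0 hv.weak)

theorem CompP.rel {u v : A → ℕ} (hu : Comp u) (hv : Comp v) :
    CompP fun a => (dat a).Rel (u a) (v a) :=
  .and (.not (.del .dataB hu)) (.and (.not (.del .dataB hv)) (.or (.eq hu hv) (.adj hu hv)))

theorem CompP.touch {u i : A → ℕ} (hu : Comp u) (hi : Comp i) :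
    CompP fun a => (dat a).Touch (u a) (i a) :=
  .or (.ex (p := fun a j => j < (dat a).b ∧ (dat a).cls j = i a ∧ (dat a).adj (u a) ((dat a).S j))
      (.and (.lt .v0 .dataB) (.and (.eq (.cls .v0) hi.weak) (.adj hu.weak (.dataS .v0)))))
    (.ex (p := fun a y => (dat a).Rel (u a) y ∧ (dat a).lab y = i a)
      (.and (.rel hu.weak .v0) (.eq (.lab .v0) hi.weak)))

theorem CompP.touchOnly {u i : A → ℕ} (hu : Comp u) (hi : Comp i) :
    CompP fun a => (dat a).TouchOnly (u a) (i a) :=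
  .all (p := fun a i' => (dat a).Touch (u a) i' → i' = i a)
    (.imp (.touch hu.weak .v0) (.eq .v0 hi.weak))

theorem CompP.pre {u : A → ℕ} (hu : Comp u) : CompP fun a => (dat a).Pre (u a) :=
  .ex (p := fun a y => (dat a).Rel (u a) y ∧ (dat a).p y ≠ 0)
    (.and (.rel hu.weak .v0) (.ne (.dataP .v0) (.const 0)))

theorem CompP.dep {i u : A → ℕ} (hi : Comp i) (hu : Comp u) :
    CompP fun a => (dat a).Dep (i a) (u a) :=
  .and (.not (.del .dataB hu)) (.and (.pre hu) (.and (.touch hu hi) (.touchOnly hu hi)))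

theorem Comp.wt {i x : A → ℕ} (hi : Comp i) (hx : Comp x) :
    Comp fun a => (dat a).wt (i a) (x a) :=
  .numBelow (p := fun a u => (dat a).Dep (i a) u ∧
      ∀ y < (dat a).n, (dat a).Rel u y → (dat a).p y ≠ 0 → (dat a).p y = x a)
    (.and (.dep hi.weak .v0)
      (.all (p := fun (a : A × ℕ) y => (dat a).Rel a.2 y → (dat a).p y ≠ 0 → (dat a).p y = x a.1)
        (.imp (.rel .v1 .v0) (.imp (.ne (.dataP .v0) (.const 0)) (.eq (.dataP .v0) hx.weak.weak)))))

theorem Comp.fixer {i : A → ℕ} (hi : Comp i) : Comp fun a => (dat a).fixer (i a) :=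
  .leastBelow (p := fun a v => (dat a).lab v = i a ∧ (dat a).p v ≠ 0)
    (.and (.eq (.lab .v0) hi.weak) (.ne (.dataP .v0) (.const 0)))

theorem Comp.best {i : A → ℕ} (hi : Comp i) : Comp fun a => (dat a).best (i a) :=
  .leastBelow (p := fun a x => (dat a).p x ≠ 0 ∧ ∀ x' < (dat a).n, (dat a).p x' ≠ 0 →
      (dat a).wt (i a) ((dat a).p x') ≤ (dat a).wt (i a) ((dat a).p x))
    (.and (.ne (.dataP .v0) (.const 0)) (.all (p := fun (a : A × ℕ) x' => (dat a).p x' ≠ 0 →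
      (dat a).wt (i a.1) ((dat a).p x') ≤ (dat a).wt (i a.1) ((dat a).p a.2))
      (.imp (.ne (.dataP .v0) (.const 0))
        (.le (.wt hi.weak.weak (.dataP .v0)) (.wt hi.weak.weak (.dataP .v1))))))

theorem Comp.clsCol {i : A → ℕ} (hi : Comp i) : Comp fun a => (dat a).clsCol (i a) :=
  .ite (.lt (.fixer hi) .sizeFn) (.dataP (.fixer hi))
    (.ite (.lt (.best hi) .sizeFn) (.dataP (.best hi)) (.const 1))

theorem Comp.cnt {v i : A → ℕ} (hv : Comp v) (hi : Comp i) :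
    Comp fun a => (dat a).cnt (v a) (i a) :=
  .numBelow (p := fun a u => (dat a).Rel (v a) u ∧ (dat a).TouchOnly u (i a))
    (.and (.rel hv.weak .v0) (.touchOnly .v0 hi.weak))

theorem Comp.bestCls {v : A → ℕ} (hv : Comp v) : Comp fun a => (dat a).bestCls (v a) :=
  .leastBelow (p := fun a i => ∀ i' < (dat a).n, (dat a).cnt (v a) i' ≤ (dat a).cnt (v a) i)
    (.all (p := fun (a : A × ℕ) i' => (dat a).cnt (v a.1) i' ≤ (dat a).cnt (v a.1) a.2)
      (.le (.cnt hv.weak.weak .v0) (.cnt hv.weak.weak .v1)))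

theorem Comp.preVert {v : A → ℕ} (hv : Comp v) : Comp fun a => (dat a).preVert (v a) :=
  .leastBelow (p := fun a y => (dat a).Rel (v a) y ∧ (dat a).p y ≠ 0)
    (.and (.rel hv.weak .v0) (.ne (.dataP .v0) (.const 0)))

theorem Comp.col {v : A → ℕ} (hv : Comp v) : Comp fun a => (dat a).col (v a) :=
  .ite (.ne (.dataP hv) (.const 0)) (.dataP hv)
    (.ite (.lt (.lab hv) .sizeFn) (.clsCol (.lab hv))
      (.ite (.lt (.preVert hv) .sizeFn) (.dataP (.preVert hv)) (.clsCol (.bestCls hv))))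

theorem CompP.good {l m : A → ℕ} (hl : Comp l) (hm : Comp m) :
    CompP fun a => (dat a).Good (l a) (m a) :=
  .and (.all (p := fun a v => 1 ≤ (dat a).col v ∧ (dat a).col v ≤ l a)
      (.and (.le (.const 1) (.col .v0)) (.le (.col .v0) hl.weak)))
    (.le hm (.numBelow (p := fun a u => (dat a).Happy (dat a).col u)
      (.all (p := fun (a : A × ℕ) y => (dat a).adj a.2 y → (dat a).col y = (dat a).col a.2)
        (.imp (.adj .v1 .v0) (.eq (.col .v0) (.col .v1))))))

end

/-! ### Comparing counts. -/

theorem numBelow_mono {n : ℕ} {p p' : ℕ → Prop} (h : ∀ i < n, p i → p' i) :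
    numBelow n p ≤ numBelow n p' := by
  classical
  rw [numBelow_eq, numBelow_eq]
  refine Finset.card_le_card fun i => ?_
  simp only [Finset.mem_filter, Finset.mem_range]
  exact fun hi => ⟨hi.1, h i hi.1 hi.2⟩

theorem exists_of_numBelow_ne_zero {n : ℕ} {p : ℕ → Prop} (h : numBelow n p ≠ 0) :
    ∃ i < n, p i := by
  classical
  rw [numBelow_eq] at h
  obtain ⟨i, hi⟩ := Finset.card_ne_zero.1 h
  simp only [Finset.mem_filter, Finset.mem_range] at hi
  exact ⟨i, hi⟩

/-- Counts can be compared fiber by fiber. -/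
theorem numBelow_le_of_fiberwise {n : ℕ} {p p' : ℕ → Prop} {κ : Type*} (key : ℕ → κ)
    (h : ∀ r, numBelow n (fun u => key u = r ∧ p u) ≤ numBelow n (fun u => key u = r ∧ p' u)) :
    numBelow n p ≤ numBelow n p' := by
  classical
  have e : ∀ p : ℕ → Prop, numBelow n p
      = ∑ r ∈ (Finset.range n).image key, numBelow n (fun u => key u = r ∧ p u) := by
    intro p
    rw [numBelow_eq, Finset.card_eq_sum_card_fiberwise (f := key) (t := (Finset.range n).image key)]
    · refine Finset.sum_congr rfl fun r _ => ?_
      rw [numBelow_eq, Finset.filter_filter]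
      congr 1
      ext; simp [and_comm]
    · intro u hu
      simp only [Finset.coe_filter, Finset.mem_range, Set.mem_ofPred_eq] at hu
      exact Finset.mem_coe.2 (Finset.mem_image_of_mem _ (Finset.mem_range.2 hu.1))
  rw [e p, e p']
  exact Finset.sum_le_sum fun r _ => h r

theorem exists_max_below {n : ℕ} {p : ℕ → Prop} (f : ℕ → ℕ) (h : ∃ x < n, p x) :
    ∃ x < n, p x ∧ ∀ x' < n, p x' → f x' ≤ f x := by
  classical
  obtain ⟨x, hx, hp⟩ := h
  obtain ⟨y, hy, hm⟩ := ((Finset.range n).filter p).exists_max_image f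
    ⟨x, Finset.mem_filter.2 ⟨Finset.mem_range.2 hx, hp⟩⟩
  simp only [Finset.mem_filter, Finset.mem_range] at hy hm
  exact ⟨y, hy.1, hy.2, fun x' h1 h2 => hm x' ⟨h1, h2⟩⟩

/-! ### A correct guess loses no happy vertex in total. -/

namespace Data

/-- The word encodes a correct guess for the coloring `c`, where `K` is the color of each class. -/
structure Guess (D : Data) (c K : ℕ → ℕ) : Prop where
  symm : ∀ u v, D.adj u v → D.adj v u
  lt : ∀ u v, D.adj u v → u < D.n
  le : D.b ≤ D.n
  free : D.P3Free D.b
  ext : ∀ v < D.n, D.p v ≠ 0 → c v = D.p v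
  cls_lt : ∀ j < D.b, D.cls j < D.n
  col_cls : ∀ j < D.b, c (D.S j) = K (D.cls j)
  inj : ∀ j < D.b, ∀ j' < D.b, c (D.S j) = c (D.S j') → D.cls j = D.cls j'
  happy : ∀ j < D.b, D.S j < D.n → (D.w j < D.b ↔ D.Happy c (D.S j))

variable {D : Data} {c K : ℕ → ℕ}

namespace Guess

theorem lt' (h : D.Guess c K) {u v : ℕ} (ha : D.adj u v) : v < D.n := h.lt _ _ (h.symm _ _ ha)

theorem del_iff (h : D.Guess c K) {v : ℕ} : D.Del D.b v ↔ ∃ j < D.b, D.S j = v :=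
  ⟨fun ⟨i, _, hi, e⟩ => ⟨i, hi, e⟩, fun ⟨i, hi, e⟩ => ⟨i, hi.trans_le h.le, hi, e⟩⟩

theorem src_spec (h : D.Guess c K) {i v : ℕ} (hv : v < D.n) (hs : D.Src i v) :
    ∃ j < D.b, D.cls j = i ∧ c v = c (D.S j) := by
  obtain ⟨j, _, hj, hc, rfl | ⟨hw, ha⟩⟩ := hs
  · exact ⟨j, hj, hc, rfl⟩
  · exact ⟨j, hj, hc, (h.happy j hj (h.lt _ _ ha)).1 hw v hv ha⟩

/-- Every entry of `S` that forces `v` into a class has the color `c v`, and by `inj` entries of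
equal color are in one class. So all sources of `v` name the same class. -/
theorem lab_eq (h : D.Guess c K) {i v : ℕ} (hv : v < D.n) (hi : i < D.n) (hs : D.Src i v) :
    D.lab v = i := by
  have h1 : D.lab v < D.n := leastBelow_lt_iff.2 ⟨i, hi, hs⟩
  obtain ⟨j, hj, rfl, e⟩ := h.src_spec hv hs
  obtain ⟨j', hj', e2, e'⟩ := h.src_spec hv (leastBelow_spec h1)
  exact e2.symm.trans (h.inj j' hj' j hj (e'.symm.trans e))

theorem lab_spec (h : D.Guess c K) {v : ℕ} (hv : v < D.n) (hl : D.lab v < D.n) :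
    ∃ j < D.b, D.cls j = D.lab v ∧ c v = c (D.S j) :=
  h.src_spec hv (leastBelow_spec hl)

theorem color_of_lab (h : D.Guess c K) {v : ℕ} (hv : v < D.n) (hl : D.lab v < D.n) :
    c v = K (D.lab v) := by
  obtain ⟨j, hj, e, e'⟩ := h.lab_spec hv hl
  rw [e', h.col_cls j hj, e]

/-- The fixer is precolored, so its precolor is its color under `c`, which is `K i` because it is
forced into the class. -/
theorem clsCol_of_fixer (h : D.Guess c K) {i : ℕ} (hi : i < D.n) (hf : D.fixer i < D.n) :
    D.clsCol i = K i := by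
  obtain ⟨e, hp⟩ := leastBelow_spec hf
  change D.lab (D.fixer i) = i at e
  rw [clsCol, if_pos hf, ← h.ext _ hf hp, h.color_of_lab hf (by rw [e]; exact hi), e]

/-- The only conflict could come from a precolor of `v`; but then the class has a fixer, and both
colors equal `c v`. -/
theorem col_of_lab (h : D.Guess c K) {v : ℕ} (hv : v < D.n) (hl : D.lab v < D.n) :
    D.col v = D.clsCol (D.lab v) := by
  rw [col]
  split_ifs with hp
  · rw [h.clsCol_of_fixer hl (leastBelow_lt_iff.2 ⟨v, hv, rfl, hp⟩), ← h.color_of_lab hv hl,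
      h.ext v hv hp]
  · rfl

theorem lab_deleted (h : D.Guess c K) {j : ℕ} (hj : j < D.b) (hS : D.S j < D.n) :
    D.lab (D.S j) = D.cls j :=
  h.lab_eq hS (h.cls_lt j hj) ⟨j, hj.trans_le h.le, hj, rfl, Or.inl rfl⟩

theorem col_deleted (h : D.Guess c K) {j : ℕ} (hj : j < D.b) (hS : D.S j < D.n) :
    D.col (D.S j) = D.clsCol (D.cls j) := by
  rw [h.col_of_lab hS (by rw [h.lab_deleted hj hS]; exact h.cls_lt j hj), h.lab_deleted hj hS]

/-- The neighbours of an entry guessed to be happy are forced into its class, so they share its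
color whatever color the class receives. -/
theorem happy_deleted (h : D.Guess c K) {u : ℕ} (hu : u < D.n) (hd : D.Del D.b u)
    (hc : D.Happy c u) : D.Happy D.col u := by
  obtain ⟨j, hj, rfl⟩ := h.del_iff.1 hd
  intro y hy ha
  have hw := (h.happy j hj hu).2 hc
  have hl := h.lab_eq hy (h.cls_lt j hj) ⟨j, hj.trans_le h.le, hj, rfl, Or.inr ⟨hw, ha⟩⟩
  rw [h.col_deleted hj hu, h.col_of_lab hy (by rw [hl]; exact h.cls_lt j hj), hl]

theorem rel_symm (h : D.Guess c K) {u v : ℕ} (huv : D.Rel u v) : D.Rel v u :=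
  ⟨huv.2.1, huv.1, huv.2.2.imp Eq.symm (h.symm _ _)⟩

/-- A failure of transitivity would be an induced path on three vertices that avoids `S`. -/
theorem rel_trans (h : D.Guess c K) {u v w : ℕ} (huv : D.Rel u v) (hvw : D.Rel v w) :
    D.Rel u w := by
  obtain ⟨hu, hv, rfl | h1⟩ := huv
  · exact hvw
  obtain ⟨_, hw, rfl | h2⟩ := hvw
  · exact ⟨hu, hv, Or.inr h1⟩
  refine ⟨hu, hw, ?_⟩
  by_contra hn
  push Not at hn
  exact h.free ⟨u, h.lt _ _ h1, v, h.lt _ _ h2, w, h.lt' h2, h1, h2, hn.1, hn.2, hu, hv, hw⟩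

theorem rel_eq (h : D.Guess c K) {u v : ℕ} (huv : D.Rel u v) : D.Rel u = D.Rel v :=
  funext fun _ => propext ⟨h.rel_trans (h.rel_symm huv), h.rel_trans huv⟩

/-- A criterion for an undeleted vertex to be happy. -/
theorem happy_col (h : D.Guess c K) {u a : ℕ} (hd : ¬ D.Del D.b u) (hu : u < D.n)
    (hr : ∀ y < D.n, D.Rel u y → D.col y = a)
    (hs : ∀ j < D.b, D.adj u (D.S j) → D.clsCol (D.cls j) = a) : D.Happy D.col u := by
  intro y hy ha
  rw [hr u hu ⟨hd, hd, Or.inl rfl⟩]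
  by_cases hdy : D.Del D.b y
  · obtain ⟨j, hj, rfl⟩ := h.del_iff.1 hdy
    rw [h.col_deleted hj hy, hs j hj ha]
  · exact hr y hy ⟨hd, hdy, Or.inr ha⟩

theorem touch_of_adj (h : D.Guess c K) {u j : ℕ} (hj : j < D.b) (ha : D.adj u (D.S j)) :
    D.Touch u (D.cls j) :=
  Or.inl ⟨j, hj.trans_le h.le, hj, rfl, ha⟩

theorem color_of_rel {u y : ℕ} (hc : D.Happy c u) (hy : y < D.n)
    (hr : D.Rel u y) : c y = c u := by
  obtain ⟨_, _, rfl | ha⟩ := hr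
  exacts [rfl, hc y hy ha]

theorem touch_spec (h : D.Guess c K) {u i : ℕ} (hi : i < D.n) (hc : D.Happy c u)
    (ht : D.Touch u i) : ∃ j < D.b, D.cls j = i ∧ c u = c (D.S j) := by
  obtain ⟨j, _, hj, e, ha⟩ | ⟨y, hy, hr, rfl⟩ := ht
  · exact ⟨j, hj, e, (hc _ (h.lt' ha) ha).symm⟩
  · obtain ⟨j, hj, e, e'⟩ := h.lab_spec hy hi
    exact ⟨j, hj, e, (color_of_rel hc hy hr).symm.trans e'⟩

theorem touch_color (h : D.Guess c K) {u i : ℕ} (hi : i < D.n) (hc : D.Happy c u)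
    (ht : D.Touch u i) : c u = K i := by
  obtain ⟨j, hj, rfl, e⟩ := h.touch_spec hi hc ht
  rw [e, h.col_cls j hj]

/-- A happy vertex has the color of an entry of `S` in each class it touches, and entries of equal
color are in one class. -/
theorem touch_unique (h : D.Guess c K) {u u' i i' : ℕ} (hi : i < D.n) (hi' : i' < D.n)
    (hc : D.Happy c u) (hc' : D.Happy c u') (e : c u = c u')
    (ht : D.Touch u i) (ht' : D.Touch u' i') : i = i' := by
  obtain ⟨j, hj, rfl, e1⟩ := h.touch_spec hi hc ht
  obtain ⟨j', hj', rfl, e2⟩ := h.touch_spec hi' hc' ht'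
  exact h.inj j hj j' hj' (by rw [← e1, ← e2, e])

theorem preVert_spec (h : D.Guess c K) {u y : ℕ} (hr : D.Rel u y) (hp : D.Pre u) :
    D.preVert y < D.n ∧ D.Rel u (D.preVert y) ∧ D.p (D.preVert y) ≠ 0 := by
  obtain ⟨z, hz, hrz, hpz⟩ := hp
  have h1 : D.preVert y < D.n :=
    leastBelow_lt_iff.2 ⟨z, hz, h.rel_trans (h.rel_symm hr) hrz, hpz⟩
  obtain ⟨h2, h3⟩ := leastBelow_spec h1
  exact ⟨h1, h.rel_trans hr h2, h3⟩

/-- All vertices of a precolored clique get the color `a`, if this is the color of all its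
precolored vertices and of all classes that it touches. -/
theorem col_of_pre (h : D.Guess c K) {u y a : ℕ} (hp : D.Pre u) (hy : y < D.n) (hr : D.Rel u y)
    (hpa : ∀ y < D.n, D.Rel u y → D.p y ≠ 0 → D.p y = a)
    (hta : ∀ i < D.n, D.Touch u i → D.clsCol i = a) : D.col y = a := by
  rw [col]
  split_ifs with h1 h2 h3
  · exact hpa y hy hr h1
  · exact hta _ h2 (Or.inr ⟨y, hy, hr, rfl⟩)
  · obtain ⟨h4, h5, h6⟩ := h.preVert_spec hr hp
    exact hpa _ h4 h5 h6
  · exact absurd (h.preVert_spec hr hp).1 h3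

theorem happy_of_pre (h : D.Guess c K) {u a : ℕ} (hd : ¬ D.Del D.b u) (hu : u < D.n)
    (hp : D.Pre u) (hpa : ∀ y < D.n, D.Rel u y → D.p y ≠ 0 → D.p y = a)
    (hta : ∀ i < D.n, D.Touch u i → D.clsCol i = a) : D.Happy D.col u :=
  h.happy_col hd hu (fun _ hy hr => h.col_of_pre hp hy hr hpa hta)
    fun j hj ha => hta _ (h.cls_lt j hj) (h.touch_of_adj hj ha)

theorem pre_color (h : D.Guess c K) {u y : ℕ} (hc : D.Happy c u) (hy : y < D.n)
    (hr : D.Rel u y) (hp : D.p y ≠ 0) : D.p y = c u :=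
  (h.ext y hy hp).symm.trans (color_of_rel hc hy hr)

/-- Touched classes with a fixer have the same color in the construction as under `c`, so `c u` is
still the only color demanded in the clique of `u`. -/
theorem happy_of_fixed (h : D.Guess c K) {u : ℕ} (hd : ¬ D.Del D.b u) (hu : u < D.n)
    (hp : D.Pre u) (hc : D.Happy c u) (hf : ∀ i < D.n, D.Touch u i → D.fixer i < D.n) :
    D.Happy D.col u :=
  h.happy_of_pre hd hu hp (fun _ hy hr hpy => h.pre_color hc hy hr hpy) fun i hi ht =>
    (h.clsCol_of_fixer hi (hf i hi ht)).trans (h.touch_color hi hc ht).symm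

theorem dep_unique {i i' u : ℕ} (hi : i < D.n) (h1 : D.Dep i u) (h2 : D.Dep i' u) : i = i' :=
  h2.2.2.2 i hi h1.2.2.1

theorem wt_le (D : Data) {i y : ℕ} (hf : ¬ D.fixer i < D.n) (hy : y < D.n) (hp : D.p y ≠ 0) :
    D.wt i (D.p y) ≤ D.wt i (D.clsCol i) := by
  obtain ⟨x, hx, hpx, hm⟩ := exists_max_below (p := fun x => D.p x ≠ 0)
    (fun x => D.wt i (D.p x)) ⟨y, hy, hp⟩
  have h1 : D.best i < D.n := leastBelow_lt_iff.2 ⟨x, hx, hpx, hm⟩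
  rw [clsCol, if_neg hf, if_pos h1]
  exact (leastBelow_spec h1).2 y hy hp

/-- A dependent vertex that is happy under `c` sees only precolors equal to `K i` in its clique, so
`wt i (K i)` bounds the left side. The construction makes everything counted by `wt i (clsCol i)`
happy. A positive weight makes `K i` a precolor in use, hence a candidate for `best`. -/
theorem count_dep (h : D.Guess c K) {i : ℕ} (hi : i < D.n) (hf : ¬ D.fixer i < D.n) :
    numBelow D.n (fun u => D.Dep i u ∧ D.Happy c u) ≤
      numBelow D.n (fun u => D.Dep i u ∧ D.Happy D.col u) := by
  have h1 : numBelow D.n (fun u => D.Dep i u ∧ D.Happy c u) ≤ D.wt i (K i) :=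
    numBelow_mono fun u hu ⟨hd, hc⟩ => ⟨hd, fun y hy hr hp =>
      (h.pre_color hc hy hr hp).trans (h.touch_color hi hc hd.2.2.1)⟩
  have h3 : D.wt i (D.clsCol i) ≤ numBelow D.n (fun u => D.Dep i u ∧ D.Happy D.col u) :=
    numBelow_mono fun u hu ⟨hd, hc⟩ => ⟨hd, h.happy_of_pre hd.1 hu hd.2.1 hc
      fun i' hi' ht => by rw [hd.2.2.2 i' hi' ht]⟩
  rcases Nat.eq_zero_or_pos (D.wt i (K i)) with h0 | h0
  · omega
  · obtain ⟨u, hu, hd, hpu⟩ := exists_of_numBelow_ne_zero h0.ne'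
    obtain ⟨y, hy, hr, hp⟩ := hd.2.1
    have h2 := wt_le D hf hy hp
    rw [hpu y hy hr hp] at h2
    omega

/-- The least vertex in the clique of `u`. -/
noncomputable def _root_.Data.root (D : Data) (u : ℕ) : ℕ := leastBelow D.n (D.Rel u)

theorem rel_of_root (h : D.Guess c K) {u v : ℕ} (hu : u < D.n) (hv : v < D.n)
    (hdu : ¬ D.Del D.b u) (hdv : ¬ D.Del D.b v) (e : D.root u = D.root v) : D.Rel u v := by
  have h1 : D.root u < D.n := leastBelow_lt_iff.2 ⟨u, hu, hdu, hdu, Or.inl rfl⟩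
  have h2 : D.root v < D.n := leastBelow_lt_iff.2 ⟨v, hv, hdv, hdv, Or.inl rfl⟩
  have h3 : D.Rel u (D.root u) := leastBelow_spec h1
  have h4 : D.Rel v (D.root v) := leastBelow_spec h2
  rw [e] at h3
  exact h.rel_trans h3 (h.rel_symm h4)

/-- The happy vertices of a clique share one color, so together they touch at most one class `i` and
are all counted by `cnt v i`. The construction gives the clique the color of the class with the
largest count, and every vertex counted there becomes happy. -/
theorem count_free (h : D.Guess c K) (r : ℕ) :
    numBelow D.n (fun u => (¬ D.Del D.b u ∧ ¬ D.Pre u ∧ D.root u = r) ∧ D.Happy c u) ≤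
      numBelow D.n (fun u => (¬ D.Del D.b u ∧ ¬ D.Pre u ∧ D.root u = r) ∧ D.Happy D.col u) := by
  by_cases h0 : numBelow D.n
      (fun u => (¬ D.Del D.b u ∧ ¬ D.Pre u ∧ D.root u = r) ∧ D.Happy c u) = 0
  · rw [h0]; exact Nat.zero_le _
  obtain ⟨v, hv, ⟨hdv, hpv, hrv⟩, hcv⟩ := exists_of_numBelow_ne_zero h0
  have hin : ∃ i < D.n, numBelow D.n
      (fun u => (¬ D.Del D.b u ∧ ¬ D.Pre u ∧ D.root u = r) ∧ D.Happy c u) ≤ D.cnt v i := by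
    by_cases ht : ∃ u < D.n, ((¬ D.Del D.b u ∧ ¬ D.Pre u ∧ D.root u = r) ∧ D.Happy c u) ∧
        ∃ i < D.n, D.Touch u i
    · obtain ⟨u, hu, ⟨⟨hdu, hpu, hru⟩, hcu⟩, i, hi, hti⟩ := ht
      refine ⟨i, hi, numBelow_mono ?_⟩
      rintro x hx ⟨⟨hdx, hpx, hrx⟩, hcx⟩
      refine ⟨h.rel_of_root hv hx hdv hdx (hrv.trans hrx.symm), fun i' hi' hti' => ?_⟩
      refine h.touch_unique hi' hi hcx hcu ?_ hti' hti
      exact color_of_rel hcu hx (h.rel_of_root hu hx hdu hdx (hru.trans hrx.symm))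
    -- No class is touched by a happy vertex here, so any index below `n` serves; `v` is merely one
    -- at hand.
    · refine ⟨v, hv, numBelow_mono ?_⟩
      rintro x hx ⟨⟨hdx, hpx, hrx⟩, hcx⟩
      refine ⟨h.rel_of_root hv hx hdv hdx (hrv.trans hrx.symm), fun i' hi' hti' => ?_⟩
      exact absurd ⟨x, hx, ⟨⟨hdx, hpx, hrx⟩, hcx⟩, i', hi', hti'⟩ ht
  obtain ⟨i, hi, hle⟩ := hin
  obtain ⟨m, hm, -, hmax⟩ := exists_max_below (p := fun _ => True) (D.cnt v) ⟨i, hi, trivial⟩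
  have hb : D.bestCls v < D.n :=
    leastBelow_lt_iff.2 ⟨m, hm, fun i' hi' => hmax i' hi' trivial⟩
  have hbs : D.cnt v i ≤ D.cnt v (D.bestCls v) := leastBelow_spec hb i hi
  refine (hle.trans hbs).trans (numBelow_mono ?_)
  rintro x hx ⟨hvx, hto⟩
  have e := h.rel_eq hvx
  have hpx : ¬ D.Pre x := by
    rw [Pre, ← e]; exact hpv
  refine ⟨⟨hvx.2.1, hpx, by rw [root, ← e]; exact hrv⟩, ?_⟩
  refine h.happy_col (a := D.clsCol (D.bestCls v)) hvx.2.1 hx (fun y hy hr => ?_) fun j hj ha => by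
    rw [hto _ (h.cls_lt j hj) (h.touch_of_adj hj ha)]
  have e' := e.trans (h.rel_eq hr)
  rw [col]
  split_ifs with h1 h2 h3
  · exact absurd ⟨y, hy, hr, h1⟩ hpx
  · rw [hto _ h2 (Or.inr ⟨y, hy, hr, rfl⟩)]
  · obtain ⟨h4, h5⟩ := leastBelow_spec h3
    exact absurd ⟨_, h3, h.rel_trans hr h4, h5⟩ hpx
  · have : D.bestCls y = D.bestCls v := by
      have hc : D.cnt y = D.cnt v := by funext i'; simp only [cnt, e']
      simp only [bestCls, hc]
    rw [this]

/-- A correct guess yields a coloring with at least as many happy vertices. -/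
theorem count_happy_le (h : D.Guess c K) :
    numBelow D.n (D.Happy c) ≤ numBelow D.n (D.Happy D.col) := by
  classical
  -- Three kinds of fibers: cliques without precolors, indexed by their root; dependent vertices of
  -- a class without fixer, indexed by the class; and single vertices, whose happiness is preserved
  -- individually.
  let F : ℕ → Prop := fun u => ¬ D.Del D.b u ∧ ¬ D.Pre u
  let E : ℕ → ℕ → Prop := fun u i => i < D.n ∧ D.Dep i u ∧ ¬ D.fixer i < D.n
  let key : ℕ → ℕ × ℕ := fun u =>
    if F u then (0, D.root u) else if hE : ∃ i, E u i then (1, hE.choose) else (2, u)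
  refine numBelow_le_of_fiberwise key ?_
  have k0 : ∀ u r, key u = (0, r) ↔ ¬ D.Del D.b u ∧ ¬ D.Pre u ∧ D.root u = r := by
    intro u r
    simp only [key]
    split_ifs with h1 h2
    · simp only [Prod.mk.injEq, true_and]
      exact ⟨fun e => ⟨h1.1, h1.2, e⟩, fun e => e.2.2⟩
    · simp only [Prod.mk.injEq, one_ne_zero, false_and, false_iff]
      exact fun e => h1 ⟨e.1, e.2.1⟩
    · simp only [Prod.mk.injEq, OfNat.ofNat_ne_zero, false_and, false_iff]
      exact fun e => h1 ⟨e.1, e.2.1⟩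
  have k1 : ∀ u i, key u = (1, i) ↔ E u i := by
    intro u i
    simp only [key]
    split_ifs with h1 h2
    · simp only [Prod.mk.injEq, zero_ne_one, false_and, false_iff]
      exact fun e => h1.2 e.2.1.2.1
    · simp only [Prod.mk.injEq, true_and]
      refine ⟨fun e => e ▸ h2.choose_spec, fun e => ?_⟩
      exact dep_unique h2.choose_spec.1 h2.choose_spec.2.1 e.2.1
    · simp only [Prod.mk.injEq, OfNat.ofNat_ne_one, false_and, false_iff]
      exact fun e => h2 ⟨i, e⟩
  rintro ⟨t, r⟩
  by_cases t0 : t = 0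
  · subst t0
    simp only [k0]
    exact h.count_free r
  by_cases t1 : t = 1
  · subst t1
    simp only [k1, E]
    by_cases hr : r < D.n ∧ ¬ D.fixer r < D.n
    · simpa [hr] using h.count_dep hr.1 hr.2
    · refine numBelow_mono ?_
      rintro u _ ⟨⟨h1, _, h2⟩, _⟩
      exact absurd ⟨h1, h2⟩ hr
  refine numBelow_mono ?_
  rintro u hu ⟨hk, hc⟩
  refine ⟨hk, ?_⟩
  by_cases hd : D.Del D.b u
  · exact h.happy_deleted hu hd hc
  have hp : D.Pre u := by
    by_contra hp
    have := (k0 u (D.root u)).2 ⟨hd, hp, rfl⟩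
    rw [hk, Prod.mk.injEq] at this
    exact t0 this.1
  refine h.happy_of_fixed hd hu hp hc fun i hi ht => ?_
  by_contra hf
  -- A happy vertex touches no class but `i`, so without a fixer of `i` it would lie in a fiber of
  -- the second kind.
  have := (k1 u i).2 ⟨hi, ⟨hd, hp, ht, fun i' hi' ht' => h.touch_unique hi' hi hc hc rfl ht' ht⟩, hf⟩
  rw [hk, Prod.mk.injEq] at this
  exact t1 this.1

end Guess
end Data

/-! ### Existence of the right words. -/

namespace Data

/-- Replace the list of deleted vertices and the word. -/
def setSW (D : Data) (S w : ℕ → ℕ) : Data := { D with S := S, w := w }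

variable {D : Data}

theorem clsCol_cases (D : Data) (i : ℕ) :
    D.clsCol i = 1 ∨ ∃ x < D.n, D.p x ≠ 0 ∧ D.clsCol i = D.p x := by
  rw [clsCol]
  split_ifs with h1 h2
  · exact Or.inr ⟨_, h1, (leastBelow_spec h1).2, rfl⟩
  · exact Or.inr ⟨_, h2, (leastBelow_spec h2).1, rfl⟩
  · exact Or.inl rfl

theorem col_cases (D : Data) {v : ℕ} (hv : v < D.n) :
    D.col v = 1 ∨ ∃ x < D.n, D.p x ≠ 0 ∧ D.col v = D.p x := by
  rw [col]
  split_ifs with h1 h2 h3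
  · exact Or.inr ⟨v, hv, h1, rfl⟩
  · exact clsCol_cases D _
  · exact Or.inr ⟨_, h3, (leastBelow_spec h3).2, rfl⟩
  · exact clsCol_cases D _

/-- The construction uses only precolors, which are legal because `c` uses them, and the default
color `1`, which is legal because `c` colors some vertex. -/
theorem Guess.good {c K : ℕ → ℕ} (h : D.Guess c K) {l m : ℕ}
    (hl : ∀ v < D.n, 1 ≤ c v ∧ c v ≤ l) (hm : m ≤ numBelow D.n (D.Happy c)) : D.Good l m := by
  refine ⟨fun v hv => ?_, hm.trans h.count_happy_le⟩
  obtain e | ⟨x, hx, hp, e⟩ := D.col_cases hv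
  · rw [e]; exact ⟨le_rfl, (hl v hv).1.trans (hl v hv).2⟩
  · rw [e, ← h.ext x hx hp]; exact hl x hx

/-- For every coloring some word encodes a correct guess. -/
theorem exists_word_good (hs : ∀ u v, D.adj u v → D.adj v u) (hlt : ∀ u v, D.adj u v → u < D.n)
    (hb : D.b ≤ D.n) (hf : D.P3Free D.b) {c : ℕ → ℕ} {l m : ℕ}
    (hl : ∀ v < D.n, 1 ≤ c v ∧ c v ≤ l) (hext : ∀ v < D.n, D.p v ≠ 0 → c v = D.p v)
    (hm : m ≤ numBelow D.n (D.Happy c)) :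
    ∃ w : ℕ → ℕ, (∀ j < D.b, w j < D.b + D.b) ∧
      ∀ w' : ℕ → ℕ, (∀ j < D.b, w' j = w j) → (D.setSW D.S w').Good l m := by
  classical
  -- A class is named by the least index in `S` of its color, which is below `b`; adding `b` marks
  -- an entry as unhappy.
  let r : ℕ → ℕ := fun j => leastBelow D.b fun i => c (D.S i) = c (D.S j)
  have hr : ∀ j < D.b, r j < D.b := fun j hj => leastBelow_lt_iff.2 ⟨j, hj, rfl⟩
  let w : ℕ → ℕ := fun j => if D.Happy c (D.S j) then r j else r j + D.b
  refine ⟨w, fun j hj => ?_, fun w' hw' => ?_⟩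
  · have := hr j hj
    simp only [w]
    split_ifs <;> omega
  have hcls : ∀ j < D.b, (D.setSW D.S w').cls j = r j := by
    intro j hj
    have h1 := hr j hj
    simp only [cls, setSW, hw' j hj, w, min_eq_left hb]
    split_ifs <;> omega
  refine Guess.good (c := c) (K := fun i => c (D.S i)) ?_ hl hm
  exact
    { symm := hs
      lt := hlt
      le := hb
      free := hf
      ext := hext
      cls_lt := fun j hj => by rw [hcls j hj]; exact (hr j hj).trans_le hb
      col_cls := fun j hj => by rw [hcls j hj]; exact (leastBelow_spec (hr j hj)).symm
      inj := fun j hj j' hj' e => by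
        rw [hcls j hj, hcls j' hj']
        have e' : c (D.S j) = c (D.S j') := e
        simp only [r, e']
      happy := fun j hj _ => by
        have h1 := hr j hj
        change w' j < D.b ↔ D.Happy c (D.S j)
        simp only [hw' j hj, w]
        split_ifs with h2
        · simp [h1, h2]
        · simp [h2] }

/-- Cells from position `j` on have arbitrary contents during the computation; this and the next
lemmas show that they have no influence on the `j`-th pick. -/
theorem del_congr {S S' w w' : ℕ → ℕ} {j : ℕ} (h : ∀ i < j, S i = S' i) :
    (D.setSW S w).Del j = (D.setSW S' w').Del j := by
  funext v
  refine propext ⟨?_, ?_⟩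
  · rintro ⟨i, hi, hij, e⟩; exact ⟨i, hi, hij, (h i hij).symm.trans e⟩
  · rintro ⟨i, hi, hij, e⟩; exact ⟨i, hi, hij, (h i hij).trans e⟩

theorem isP3_congr {S S' w w' : ℕ → ℕ} {j : ℕ} (h : ∀ i < j, S i = S' i) :
    (D.setSW S w).IsP3 j = (D.setSW S' w').IsP3 j := by
  unfold IsP3
  rw [del_congr h]
  rfl

theorem p3Free_congr {S S' w w' : ℕ → ℕ} {j : ℕ} (h : ∀ i < j, S i = S' i) :
    (D.setSW S w).P3Free j ↔ (D.setSW S' w').P3Free j := by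
  unfold P3Free
  rw [isP3_congr h]
  rfl

theorem pick_congr {S S' w w' : ℕ → ℕ} {j : ℕ} (h : ∀ i < j, S i = S' i) (hw : w j = w' j) :
    (D.setSW S w).pick j = (D.setSW S' w').pick j := by
  have e := isP3_congr (D := D) (w := w) (w' := w') h
  have e1 : (D.setSW S w).p3x j = (D.setSW S' w').p3x j := by unfold p3x; rw [e]; rfl
  have e2 : (D.setSW S w).p3y j = (D.setSW S' w').p3y j := by unfold p3y; rw [e, e1]; rfl
  have e3 : (D.setSW S w).p3z j = (D.setSW S' w').p3z j := by unfold p3z; rw [e, e1, e2]; rfl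
  have e4 : (D.setSW S w).w j = (D.setSW S' w').w j := hw
  unfold pick
  rw [e1, e2, e3, e4]

theorem P3Free.succ {j : ℕ} (h : D.P3Free j) : D.P3Free (j + 1) := by
  rintro ⟨x, hx, y, hy, z, hz, h1, h2, h3, h4, h5, h6, h7⟩
  have hd : ∀ v, ¬ D.Del (j + 1) v → ¬ D.Del j v :=
    fun v hv ⟨i, hi, hij, e⟩ => hv ⟨i, hi, by omega, e⟩
  exact h ⟨x, hx, y, hy, z, hz, h1, h2, h3, h4, hd _ h5, hd _ h6, hd _ h7⟩

theorem isP3_first {j : ℕ} (h : ¬ D.P3Free j) :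
    D.IsP3 j (D.p3x j) (D.p3y j) (D.p3z j) := by
  rw [P3Free, not_not] at h
  have h1 := leastBelow_spec (leastBelow_lt_iff.2 h)
  have h2 := leastBelow_spec (leastBelow_lt_iff.2 h1)
  exact leastBelow_spec (leastBelow_lt_iff.2 h2)

/-- Branching on induced paths on three vertices: for some choices, the vertices that are picked
contain a given modulator or leave no induced path. -/
theorem exists_picks {D : Data} {X : Finset ℕ} {b : ℕ} (hb : b ≤ D.n) (hX : X.card ≤ b)
    (hP : ∀ x y z, D.adj x y → D.adj y z → x ≠ z → ¬ D.adj x z → x ∈ X ∨ y ∈ X ∨ z ∈ X) :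
    ∀ j ≤ b, ∃ S w : ℕ → ℕ, (∀ i, w i < 3) ∧ (∀ i < j, S i = (D.setSW S w).pick i) ∧
      ((D.setSW S w).P3Free j ∨ (X \ (Finset.range j).image S).card + j ≤ b) := by
  intro j
  induction j with
  | zero => exact fun _ => ⟨fun _ => 0, fun _ => 0, by simp, by simp, Or.inr (by simpa using hX)⟩
  | succ j ih =>
    intro hj
    obtain ⟨S, w, hw, hS, hor⟩ := ih (by omega)
    -- it suffices to choose the digit at `j`
    have key : ∀ t < 3, ∀ v, (D.setSW S (Function.update w j t)).pick j = v →
        ((D.setSW (Function.update S j v) (Function.update w j t)).P3Free (j + 1) ∨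
          (X \ (Finset.range (j + 1)).image (Function.update S j v)).card + (j + 1) ≤ b) →
        ∃ S w : ℕ → ℕ, (∀ i, w i < 3) ∧ (∀ i < j + 1, S i = (D.setSW S w).pick i) ∧
      ((D.setSW S w).P3Free (j + 1) ∨ (X \ (Finset.range (j + 1)).image S).card + (j + 1) ≤ b) := by
      intro t ht v hv hor'
      refine ⟨_, Function.update w j t, fun i => ?_, fun i hi => ?_, hor'⟩
      · by_cases hij : i = j
        · subst hij; simpa using ht
        · simpa [Function.update_of_ne hij] using hw i
      · rcases Nat.lt_succ_iff_lt_or_eq.1 hi with hij | rfl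
        · rw [Function.update_of_ne hij.ne, hS i hij]
          exact pick_congr (fun i' hi' => (Function.update_of_ne (by omega) _ _).symm)
            (Function.update_of_ne hij.ne _ _).symm
        · rw [Function.update_self, ← hv]
          exact pick_congr (fun i' hi' => (Function.update_of_ne (by omega) _ _).symm) rfl
    by_cases hfree : (D.setSW S w).P3Free j
    -- With no path left the letter is immaterial.
    · refine key 0 (by omega) _ rfl (Or.inl (P3Free.succ ?_))
      exact (p3Free_congr fun i hi => (Function.update_of_ne (by omega) _ _).symm).1 hfree
    have hcard := hor.resolve_left hfree
    have hfree' : ∀ t, ¬ (D.setSW S (Function.update w j t)).P3Free j :=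
      fun t ht => hfree ((p3Free_congr fun _ _ => rfl).1 ht)
    -- A pick in `X` that was not picked before shrinks the uncovered part of `X` by one, which pays
    -- for the step from `j` to `j + 1`.
    have fin : ∀ t < 3, ∀ v ∈ X, (D.setSW S (Function.update w j t)).pick j = v →
        ¬ (D.setSW S w).Del j v → ∃ S w : ℕ → ℕ, (∀ i, w i < 3) ∧
        (∀ i < j + 1, S i = (D.setSW S w).pick i) ∧ ((D.setSW S w).P3Free (j + 1) ∨
          (X \ (Finset.range (j + 1)).image S).card + (j + 1) ≤ b) := by
      intro t ht v hvX hv hdel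
      refine key t ht v hv (Or.inr ?_)
      have hsub : X \ (Finset.range (j + 1)).image (Function.update S j v) ⊂
          X \ (Finset.range j).image S := by
        refine Finset.ssubset_iff_subset_ne.2 ⟨fun x hx => ?_, fun e => ?_⟩
        · simp only [Finset.mem_sdiff, Finset.mem_image, Finset.mem_range, not_exists,
            not_and] at hx ⊢
          refine ⟨hx.1, fun i hi e => hx.2 i (by omega) ?_⟩
          rw [Function.update_of_ne (by omega), e]
        · have h1 : v ∈ X \ (Finset.range j).image S := by
            simp only [Finset.mem_sdiff, Finset.mem_image, Finset.mem_range, not_exists, not_and]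
            exact ⟨hvX, fun i hi e => hdel ⟨i, show i < D.n by omega, hi, e⟩⟩
          rw [← e] at h1
          simp only [Finset.mem_sdiff, Finset.mem_image, Finset.mem_range, not_exists,
            not_and] at h1
          exact h1.2 j (by omega) (Function.update_self ..)
      have := Finset.card_lt_card hsub
      omega
    have eP : ∀ t, (D.setSW S (Function.update w j t)).IsP3 j = (D.setSW S w).IsP3 j :=
      fun t => isP3_congr fun _ _ => rfl
    have ht : ∀ t, (D.setSW S (Function.update w j t)).w j = t := fun t => by simp [setSW]
    have h0 := isP3_first hfree
    rcases hP _ _ _ h0.1 h0.2.1 h0.2.2.1 h0.2.2.2.1 with hx | hx | hx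
    · refine fin 0 (by omega) _ hx ?_ h0.2.2.2.2.1
      rw [pick, if_pos (ht 0)]; unfold p3x; rw [eP]; rfl
    · refine fin 1 (by omega) _ hx ?_ h0.2.2.2.2.2.1
      rw [pick, if_neg (by rw [ht]; omega), if_pos (ht 1)]; unfold p3y p3x; rw [eP]; rfl
    · refine fin 2 (by omega) _ hx ?_ h0.2.2.2.2.2.2
      rw [pick, if_neg (by rw [ht]; omega), if_neg (by rw [ht]; omega)]
      unfold p3z p3y p3x; rw [eP]; rfl

/-- Some word finds a modulator if a modulator of the given size exists. -/
theorem exists_word_p3Free {X : Finset ℕ} (hb : D.b ≤ D.n) (hX : X.card ≤ D.b)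
    (hP : ∀ x y z, D.adj x y → D.adj y z → x ≠ z → ¬ D.adj x z → x ∈ X ∨ y ∈ X ∨ z ∈ X) :
    ∃ w : ℕ → ℕ, (∀ j < D.b, w j < 3) ∧ ∀ S w' : ℕ → ℕ, (∀ j < D.b, w' j = w j) →
      (∀ j < D.b, S j = (D.setSW S w').pick j) → (D.setSW S w').P3Free D.b := by
  obtain ⟨S₀, w, hw, hS₀, hor⟩ := exists_picks hb hX hP D.b le_rfl
  refine ⟨w, fun j _ => hw j, fun S w' hw' hS => ?_⟩
  -- The word determines the picks recursively, so both lists coincide.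
  have e : ∀ j, j < D.b → S₀ j = S j := by
    intro j
    induction j using Nat.strong_induction_on with
    | _ j ih =>
      intro hj
      rw [hS₀ j hj, hS j hj]
      exact pick_congr (fun i hi => ih i hi (by omega)) (hw' j hj).symm
  refine (p3Free_congr (w := w) e).1 ?_
  rcases hor with h | h
  · exact h
  -- After `b` picks the budget leaves no element of `X` uncovered.
  · have hsub : X ⊆ (Finset.range D.b).image S₀ := by
      rw [← Finset.sdiff_eq_empty_iff_subset, ← Finset.card_eq_zero]; omega
    have hdel : ∀ v ∈ X, (D.setSW S₀ w).Del D.b v := by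
      intro v hv
      obtain ⟨i, hi, e⟩ := Finset.mem_image.1 (hsub hv)
      rw [Finset.mem_range] at hi
      exact ⟨i, hi.trans_le hb, hi, e⟩
    rintro ⟨x, _, y, _, z, _, h1, h2, h3, h4, h5, h6, h7⟩
    rcases hP x y z h1 h2 h3 h4 with hx | hx | hx
    exacts [h5 (hdel _ hx), h6 (hdel _ hx), h7 (hdel _ hx)]

end Data

/-! ### Instances as contents of the store. -/

/-- The number of happy vertices that is asked for. -/
def RamState.goal (s : RamState) : ℕ := if s.reg 2 = 1 then 0 else s.reg 3

namespace MHVInstance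
variable (I : MHVInstance)

/-- Division by `n` recovers row and column from a matrix index, so distinct entries do not collide.
-/
theorem encode_adj (u v : ℕ) : I.encode.data.adj u v ↔
    ∃ (hu : u < I.n) (hv : v < I.n), I.G.Adj ⟨u, hu⟩ ⟨v, hv⟩ := by
  have h0 : I.encode.data.adj u v ↔ u < I.n ∧ v < I.n ∧
      ∃ u' v' : Fin I.n, I.G.Adj u' v' ∧ u * I.n + v = u'.val * I.n + v'.val := by
    simp [RamState.data, encode]
  rw [h0]
  constructor
  · rintro ⟨hu, hv, u', v', ha, e⟩
    have hn : 0 < I.n := by omega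
    have h1 : u = u'.val := by
      have := congrArg (· / I.n) e
      simpa [Nat.add_div_of_dvd_right, Nat.add_comm _ v, Nat.add_comm _ v'.val,
        Nat.add_mul_div_right _ _ hn, Nat.div_eq_of_lt hv, Nat.div_eq_of_lt v'.2] using this
    subst h1
    have h2 : v = v'.val := by omega
    subst h2
    exact ⟨hu, hv, ha⟩
  · rintro ⟨hu, hv, ha⟩
    exact ⟨hu, hv, _, _, ha, rfl⟩

theorem encode_p {v : ℕ} (hv : v < I.n) :
    I.encode.data.p v = match I.p ⟨v, hv⟩ with | none => 0 | some a => a.val + 1 := by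
  simp [RamState.data, encode, hv]

theorem encode_n : I.encode.data.n = I.n := by simp [RamState.data, encode]

theorem encode_goal (m : ℕ) : I.encode.goal ≤ m ↔ I.k ≤ m := by
  simp only [RamState.goal, encode]
  by_cases h : I.k < 0
  · simp [h]; omega
  · simp [h]; omega

theorem numBelow_happy (c : Fin I.n → Fin I.ℓ) (c' : ℕ → ℕ) (h : ∀ v, c' v.val = (c v).val + 1) :
    numBelow I.n (I.encode.data.Happy c') = {v | IsHappy I.G c v}.ncard := by
  classical
  rw [numBelow_eq, ← Set.ncard_coe_finset, ← Set.ncard_image_of_injective _ Fin.val_injective]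
  congr 1
  ext v
  simp only [Finset.coe_filter, Finset.mem_range, Set.mem_ofPred_eq, Set.mem_image]
  constructor
  · rintro ⟨hv, hh⟩
    refine ⟨⟨v, hv⟩, fun u hu => ?_, rfl⟩
    have := hh u.val (by rw [encode_n]; exact u.2) ((I.encode_adj _ _).2 ⟨hv, u.2, hu⟩)
    rw [h u, h ⟨v, hv⟩] at this
    exact Fin.ext (by omega)
  · rintro ⟨x, hx, rfl⟩
    refine ⟨x.2, fun y _ ha => ?_⟩
    obtain ⟨_, hy, ha⟩ := (I.encode_adj _ _).1 ha
    rw [h x, h ⟨y, hy⟩, hx _ ha]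

/-- Yes-instances in terms of the presentation to the machine. -/
theorem isYes_iff : I.IsYes ↔ ∃ c : ℕ → ℕ, (∀ v < I.n, 1 ≤ c v ∧ c v ≤ I.ℓ) ∧
    (∀ v < I.n, I.encode.data.p v ≠ 0 → c v = I.encode.data.p v) ∧
    I.encode.goal ≤ numBelow I.n (I.encode.data.Happy c) := by
  constructor
  · rintro ⟨c, hext, hk⟩
    let c' : ℕ → ℕ := fun v => if hv : v < I.n then (c ⟨v, hv⟩).val + 1 else 0
    have hc' : ∀ v : Fin I.n, c' v.val = (c v).val + 1 := fun v => by simp [c']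
    refine ⟨c', fun v hv => ?_, fun v hv hp => ?_, ?_⟩
    · rw [hc' ⟨v, hv⟩]; have := (c ⟨v, hv⟩).2; omega
    · rw [I.encode_p hv] at hp ⊢
      rw [hc' ⟨v, hv⟩]
      cases hpv : I.p ⟨v, hv⟩ with
      | none => simp [hpv] at hp
      | some a => simp [hext _ _ hpv]
    · rw [I.numBelow_happy c c' hc', encode_goal]; exact hk
  · rintro ⟨c', hr, hext, hk⟩
    let c : Fin I.n → Fin I.ℓ := fun v => ⟨c' v - 1, by have := hr v v.2; omega⟩
    have hc' : ∀ v : Fin I.n, c' v.val = (c v).val + 1 := fun v => by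
      have := hr v v.2
      simp only [c]; omega
    refine ⟨c, fun v a hp => ?_, ?_⟩
    · have h1 := hext v v.2
      rw [I.encode_p v.2, hp] at h1
      have h2 := h1 (by simp)
      rw [hc'] at h2
      exact Fin.ext (by simpa using h2)
    · rw [I.numBelow_happy c c' hc', encode_goal] at hk; exact hk

/-- The ends of a path on three vertices outside a modulator lie in one component of a cluster
graph, so they are adjacent and the path is not induced. -/
theorem exists_modulator : ∃ X : Finset ℕ, X.card = distToCluster I.G ∧
    ∀ x y z, I.encode.data.adj x y → I.encode.data.adj y z → x ≠ z → ¬ I.encode.data.adj x z →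
      x ∈ X ∨ y ∈ X ∨ z ∈ X := by
  obtain ⟨S, hS, hd⟩ := exists_isClusterModulator_card_eq I.G
  refine ⟨S.map Fin.valEmbedding, by rw [Finset.card_map, hd], fun x y z h1 h2 h3 h4 => ?_⟩
  obtain ⟨hx, hy, h1⟩ := (I.encode_adj _ _).1 h1
  obtain ⟨_, hz, h2⟩ := (I.encode_adj _ _).1 h2
  by_contra hn
  push Not at hn
  have mem : ∀ v (hv : v < I.n), v ∉ S.map Fin.valEmbedding →
      (⟨v, hv⟩ : Fin I.n) ∈ ((S : Set (Fin I.n))ᶜ) :=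
    fun v hv h h' => h (Finset.mem_map_of_mem Fin.valEmbedding (Finset.mem_coe.1 h'))
  let H := I.G.induce ((S : Set (Fin I.n))ᶜ)
  have a1 : H.Adj ⟨⟨x, hx⟩, mem x hx hn.1⟩ ⟨⟨y, hy⟩, mem y hy hn.2.1⟩ := h1
  have a2 : H.Adj ⟨⟨y, hy⟩, mem y hy hn.2.1⟩ ⟨⟨z, hz⟩, mem z hz hn.2.2⟩ := h2
  have a3 := hS (H.connectedComponentMk ⟨⟨x, hx⟩, mem x hx hn.1⟩) (x := ⟨⟨x, hx⟩, mem x hx hn.1⟩) rfl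
    (y := ⟨⟨z, hz⟩, mem z hz hn.2.2⟩)
    (SimpleGraph.ConnectedComponent.sound (a1.reachable.trans a2.reachable).symm)
    (fun e => h3 (by simpa using e))
  exact h4 ((I.encode_adj _ _).2 ⟨hx, hz, a3⟩)

theorem distToCluster_le : distToCluster I.G ≤ I.n := by
  obtain ⟨S, _, hd⟩ := exists_isClusterModulator_card_eq I.G
  rw [← hd]
  simpa using S.card_le_univ

end MHVInstance

/-! ### Enumeration of words -/

/-- The `j`-th digit of `t` in base `B`. -/
def digit (B t j : ℕ) : ℕ := t / B ^ j % B

theorem digit_zero (B j : ℕ) : digit B 0 j = 0 := by simp [digit]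

theorem digit_succ (B t j : ℕ) : digit B t (j + 1) = digit B (t / B) j := by
  rw [digit, digit, pow_succ', Nat.div_div_eq_div_mul]

theorem dvd_succ_iff {B : ℕ} (hB : 0 < B) (t : ℕ) : B ∣ t + 1 ↔ t % B + 1 = B := by
  have h := Nat.mod_lt t hB
  have e := Nat.div_add_mod t B
  constructor
  · intro hd
    have h1 : B ∣ t % B + 1 := by
      have : t + 1 = B * (t / B) + (t % B + 1) := by omega
      rw [this] at hd
      exact (Nat.dvd_add_right (Nat.dvd_mul_right _ _)).1 hd
    have := Nat.le_of_dvd (by omega) h1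
    omega
  · intro h1
    exact ⟨t / B + 1, by rw [Nat.mul_add]; omega⟩

/-- A carry reaches position `j` exactly when all lower digits are `B - 1`; the induction passes
from `t` to `t / B`. -/
theorem digit_inc {B : ℕ} (hB : 0 < B) (j : ℕ) : ∀ t, digit B (t + 1) j =
    if ∀ i < j, digit B t i + 1 = B then (if digit B t j + 1 = B then 0 else digit B t j + 1)
    else digit B t j := by
  induction j with
  | zero =>
    intro t
    simp only [digit, pow_zero, Nat.div_one, Nat.not_lt_zero, false_imp_iff, implies_true, if_true]
    have h := Nat.mod_lt t hB
    split_ifs with h1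
    · exact Nat.mod_eq_zero_of_dvd ((dvd_succ_iff hB t).2 h1)
    · rw [Nat.add_mod, Nat.mod_eq_of_lt (a := 1) (by omega), Nat.mod_eq_of_lt (by omega)]
  | succ j ih =>
    intro t
    have hc : (∀ i < j + 1, digit B t i + 1 = B) ↔
        t % B + 1 = B ∧ ∀ i < j, digit B (t / B) i + 1 = B := by
      constructor
      · intro h
        exact ⟨by simpa [digit] using h 0 (by omega),
          fun i hi => by rw [← digit_succ]; exact h (i + 1) (by omega)⟩
      · rintro ⟨h0, h⟩ (_ | i) hi
        · simpa [digit] using h0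
        · rw [digit_succ]; exact h i (by omega)
    rw [digit_succ, digit_succ, Nat.succ_div]
    simp only [hc, dvd_succ_iff hB]
    by_cases h1 : t % B + 1 = B
    · simp only [h1, if_true, ih, true_and]
    · simp only [h1, if_false, false_and, Nat.add_zero]

/-- This recognizes the last word. The alternative `M = 0` admits the empty alphabet, which occurs
when the modulator is empty; the empty word is then the only one. -/
theorem all_digit_iff {B : ℕ} (M : ℕ) (hB : 0 < B ∨ M = 0) :
    ∀ t, (∀ j < M, digit B t j + 1 = B) ↔ B ^ M ∣ t + 1 := by
  rcases hB with hB | rfl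
  swap
  · simp
  induction M with
  | zero => simp
  | succ M ih =>
    intro t
    constructor
    · intro h
      have h0 : t % B + 1 = B := by simpa [digit] using h 0 (by omega)
      have h1 : B ^ M ∣ t / B + 1 :=
        (ih _).1 fun j hj => by rw [← digit_succ]; exact h (j + 1) (by omega)
      have e : t + 1 = B * (t / B + 1) := by
        have := Nat.div_add_mod t B
        rw [Nat.mul_add]; omega
      rw [e, pow_succ']
      exact Nat.mul_dvd_mul_left _ h1
    · intro h
      have h0 : t % B + 1 = B := (dvd_succ_iff hB t).1 ((dvd_pow_self B (by omega)).trans h)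
      have e : t + 1 = B * (t / B + 1) := by
        have := Nat.div_add_mod t B
        rw [Nat.mul_add]; omega
      rw [e, pow_succ'] at h
      have h1 := (ih _).2 (Nat.dvd_of_mul_dvd_mul_left hB h)
      rintro (_ | j) hj
      · simpa [digit] using h0
      · rw [digit_succ]; exact h1 j (by omega)

theorem exists_digits (B M : ℕ) : ∀ w : ℕ → ℕ, (∀ j < M, w j < B) →
    ∃ t < B ^ M, ∀ j < M, digit B t j = w j := by
  induction M with
  | zero => exact fun w _ => ⟨0, by simp, by simp⟩
  | succ M ih =>
    intro w hw
    obtain ⟨t, ht, h⟩ := ih (fun j => w (j + 1)) fun j hj => hw (j + 1) (by omega)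
    have h0 := hw 0 (by omega)
    have hB : 0 < B := by omega
    refine ⟨w 0 + B * t, ?_, ?_⟩
    · rw [pow_succ']
      have : B * (t + 1) ≤ B * B ^ M := Nat.mul_le_mul_left _ ht
      rw [Nat.mul_add] at this
      omega
    · rintro (_ | j) hj
      · simp [digit, Nat.mod_eq_of_lt h0]
      · rw [digit_succ, Nat.add_mul_div_left _ _ hB, Nat.div_eq_of_lt h0, Nat.zero_add]
        exact h j (by omega)

/-! ### Transformations of the store in polynomial time -/

/-- The transformation `F` of the globals is performed by a program in polynomial time. -/
def Does (F : RamState → RamState) : Prop :=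
  ∃ (P : RamProgram) (q : Polynomial ℕ), ∀ a : RamState,
    Exec numGlobals numGlobals P a (F a) (q.eval (a.reg 0)) ∧ (F a).reg 0 = a.reg 0

theorem Does.skip : Does id :=
  ⟨.skip, 1, fun a => ⟨fun s hs => ⟨s, 1, .skip s, by simp, hs⟩, rfl⟩⟩

theorem Does.seq {F G : RamState → RamState} (hF : Does F) (hG : Does G) :
    Does fun a => G (F a) := by
  obtain ⟨P, q, h⟩ := hF
  obtain ⟨Q, q', h'⟩ := hG
  refine ⟨.seq P Q, q + q', fun a => ⟨?_, (h' _).2.trans (h a).2⟩⟩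
  have := (h a).1.seq (h' (F a)).1
  rw [(h a).2] at this
  simpa using this

theorem Does.assign {f : RamState → ℕ} (r : ℕ) (hr : r < numGlobals) (hr0 : r ≠ 0)
    (hf : Comp f) : Does fun a => a.setReg r (f a) := by
  obtain ⟨P, q, h⟩ := hf
  refine ⟨.seq P (.copy r numGlobals), q + 1, fun a =>
    ⟨?_, RamState.setReg_reg_of_ne _ hr0.symm _⟩⟩
  have h1 := (h a).seq (Exec.copy (r := numGlobals) (r' := r) (Nat.lt_succ_self _) _)
  refine ((h1.mono ?_).weaken (k'' := numGlobals) (Nat.le_succ _)).post ?_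
  · simp [size, base]
  · have : depth RamState = numGlobals := rfl
    rw [this, RamState.setReg_reg_self, RamState.setReg_comm _ hr.ne']
    exact Agree.self_setReg _ le_rfl _

theorem Does.ite {p : RamState → Prop} [DecidablePred p] {F G : RamState → RamState} (hp : CompP p) (hF : Does F)
    (hG : Does G) : Does fun a => if p a then F a else G a := by
  obtain ⟨P, q, h⟩ := hp
  obtain ⟨P₁, q₁, h₁⟩ := hF
  obtain ⟨P₂, q₂, h₂⟩ := hG
  refine ⟨.seq (.seq P (.const (numGlobals + 1) 0))
    (.branch (.eq numGlobals (numGlobals + 1)) P₂ P₁), q + 1 + (1 + (q₁ + q₂)), fun a => ⟨?_, ?_⟩⟩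
  · have h3 := (h a).seq (Exec.const _ 0)
    have e : depth RamState = numGlobals := rfl
    rw [e] at h3
    have ea : ∀ v, Agree numGlobals a ((a.setReg numGlobals v).setReg (numGlobals + 1) 0) :=
      fun v => (Agree.self_setReg _ le_rfl _).trans (Agree.self_setReg _ (by omega) _)
    refine ((h3.seq (Exec.branch (c := .eq numGlobals (numGlobals + 1))
      (T := q₁.eval (a.reg 0) + q₂.eval (a.reg 0))
      ⟨by omega, by omega⟩ (fun hc => ?_) (fun hc => ?_))).mono ?_)
    · have hn : ¬ p a := by
        intro hpa
        simp [RamTest.Holds, RamState.setReg, hpa] at hc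
      simp only [if_neg hn]
      exact ((h₂ a).1.mono (Nat.le_add_left _ _)).pre (by omega) (ea _)
    · have hn : p a := by
        by_contra hpa
        simp [RamTest.Holds, RamState.setReg, hpa] at hc
      simp only [if_pos hn]
      exact ((h₁ a).1.mono (Nat.le_add_right _ _)).pre (by omega) (ea _)
    · simp [size, base]
  · beta_reduce
    split_ifs
    exacts [(h₁ a).2, (h₂ a).2]

/-- The first `k` cells of bank `b` are filled one after the other. -/
def fillTo (b : ℕ) (f : RamState → ℕ → ℕ) (a : RamState) (k : ℕ) : RamState :=
  Nat.rec a (fun i a' => a'.setMem b i (f a' i)) k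

/-- Bank `b` is filled. -/
def fill (b : ℕ) (f : RamState → ℕ → ℕ) (a : RamState) : RamState := fillTo b f a (a.reg 0)

section
variable (b : ℕ) (f : RamState → ℕ → ℕ) (a : RamState)

theorem fillTo_succ (k : ℕ) :
    fillTo b f a (k + 1) = (fillTo b f a k).setMem b k (f (fillTo b f a k) k) := rfl

theorem fillTo_reg (k : ℕ) : (fillTo b f a k).reg = a.reg := by
  induction k with
  | zero => rfl
  | succ k ih => rw [fillTo_succ, RamState.setMem_reg, ih]

theorem fillTo_mem_of_ne (k : ℕ) {b' : ℕ} (h : b' ≠ b) : (fillTo b f a k).mem b' = a.mem b' := by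
  induction k with
  | zero => rfl
  | succ k ih => rw [fillTo_succ, RamState.setMem, ← ih]; exact Function.update_of_ne h _ _

theorem fillTo_mem {k i : ℕ} (h : i < k) : (fillTo b f a k).mem b i = f (fillTo b f a i) i := by
  induction k with
  | zero => omega
  | succ k ih =>
    rw [fillTo_succ, RamState.setMem]
    rcases Nat.lt_succ_iff_lt_or_eq.1 h with h | rfl
    · simp [Function.update_of_ne h.ne, ih h]
    · simp

theorem fill_reg : (fill b f a).reg = a.reg := fillTo_reg _ _ _ _

theorem fill_mem_of_ne {b' : ℕ} (h : b' ≠ b) : (fill b f a).mem b' = a.mem b' :=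
  fillTo_mem_of_ne _ _ _ _ h

theorem fill_mem {i : ℕ} (h : i < a.reg 0) : (fill b f a).mem b i = f (fillTo b f a i) i :=
  fillTo_mem _ _ _ h

end

theorem Does.fill (b : ℕ) {f : RamState → ℕ → ℕ} (hf : Comp fun x : RamState × ℕ => f x.1 x.2) :
    Does (fill b f) := by
  obtain ⟨Q, q, h⟩ := hf
  set d := numGlobals with hd
  refine ⟨.seq (.const d 0) (.loop (.lt d 0) (.seq (.seq Q (.store b d (d + 1))) (.inc d))),
    1 + (.X * (q + 1 + 1 + 1) + 1), fun a => ⟨?_, by rw [fill_reg]⟩⟩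
  let x : ℕ → RamState := fun i => (fillTo b f a i).setReg d i
  have hx0 : ∀ i, (x i).reg 0 = a.reg 0 ∧ (x i).reg d = i := fun i =>
    ⟨by simp only [x]; rw [RamState.setReg_reg_of_ne _ (by decide), fillTo_reg], by simp [x]⟩
  have h1 : Exec d (d + 1) (.const d 0) a (x 0) 1 := Exec.const a 0
  have h2 : ∀ i, i < a.reg 0 → (RamTest.lt d 0).Holds (x i) ∧
      Exec (d + 1) (d + 1) (.seq (.seq Q (.store b d (d + 1))) (.inc d)) (x i) (x (i + 1))
        (q.eval (a.reg 0) + 1 + 1) := by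
    intro i hi
    refine ⟨by simpa only [RamTest.Holds, hx0] using hi, ?_⟩
    have h3 := ((h (fillTo b f a i, i)).seq (Exec.store (r := d + 1) (r' := d) (b := b)
      (Nat.lt_succ_self _) (Nat.lt_succ_of_lt (Nat.lt_succ_self _)) _)).seq
      (Exec.inc (r := d) (Nat.lt_succ_of_lt (Nat.lt_succ_self _)) _)
    have e1 : depth (RamState × ℕ) = d + 1 := rfl
    have e2 : rep (fillTo b f a i, i) = (fillTo b f a i).setReg d i := rfl
    have e3 : size (fillTo b f a i, i) = a.reg 0 := by
      change (fillTo b f a i).reg 0 = _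
      rw [fillTo_reg]
    rw [e1, e2, e3] at h3
    refine (h3.weaken (k'' := d + 1) (Nat.le_succ _)).post ?_
    rw [RamState.setMem_reg, RamState.setReg_reg_self,
      RamState.setReg_reg_of_ne _ (show d ≠ d + 1 by omega), RamState.setReg_reg_self]
    refine ⟨fun j hj => ?_, rfl⟩
    simp only [x]
    by_cases hjd : j = d
    · subst hjd; simp
    · rw [RamState.setReg_reg_of_ne _ hjd, RamState.setReg_reg_of_ne _ hjd, RamState.setMem_reg,
        RamState.setReg_reg_of_ne _ (show j ≠ d + 1 by omega), RamState.setReg_reg_of_ne _ hjd,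
        fillTo_reg, fillTo_reg]
  have h4 := Exec.loop (k := d + 1) (c := .lt d 0) ⟨by omega, by omega⟩ _ (a.reg 0) x h2
    (by simp only [RamTest.Holds, hx0]; omega)
  refine (((h1.seq h4).mono (by simp)).weaken (k'' := d) (by omega)).post ?_
  exact Agree.self_setReg _ le_rfl _

/-! ### Search through all words -/

/-- `a'` agrees with `a` except for the flag register `6` and the memory banks in `s`. -/
def Frame (s : Set ℕ) (a a' : RamState) : Prop :=
  (∀ r, r ≠ 6 → a'.reg r = a.reg r) ∧ ∀ b, b ∉ s → a'.mem b = a.mem b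

theorem Frame.refl (s : Set ℕ) (a : RamState) : Frame s a a := ⟨fun _ _ => rfl, fun _ _ => rfl⟩

theorem Frame.trans {s : Set ℕ} {a b c : RamState} (h : Frame s a b) (h' : Frame s b c) :
    Frame s a c :=
  ⟨fun r hr => (h'.1 r hr).trans (h.1 r hr), fun i hi => (h'.2 i hi).trans (h.2 i hi)⟩

open Classical in
/-- The increment of the word in bank `4`, a copy of which is in bank `5`. -/
noncomputable def incDigit (a : RamState) (j : ℕ) : ℕ :=
  if ∀ i < a.reg 0, i < j → a.mem 5 i + 1 = a.reg 5 then
    (if a.mem 5 j + 1 = a.reg 5 then 0 else a.mem 5 j + 1)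
  else a.mem 5 j

/-- The next word. -/
noncomputable def nextWord (a : RamState) : RamState :=
  fill 4 incDigit (fill 5 (fun a j => a.mem 4 j) a)

theorem Does.nextWord : Does nextWord := by
  have h1 : CompP fun x : RamState × ℕ => ∀ i < x.1.reg 0, i < x.2 → x.1.mem 5 i + 1 = x.1.reg 5 :=
    CompP.all (A := RamState × ℕ) (p := fun x i => i < x.2 → x.1.mem 5 i + 1 = x.1.reg 5)
      (.imp (.lt .v0 .v1) (.eq (.succ (.mem 5 .v0)) (.global 5 (by decide))))
  have h2 : Comp fun x : RamState × ℕ => incDigit x.1 x.2 :=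
    .ite h1 (.ite (.eq (.succ (.mem 5 .v0)) (.global 5 (by decide))) (.const 0)
      (.succ (.mem 5 .v0))) (.mem 5 .v0)
  have h3 : Comp fun x : RamState × ℕ => x.1.mem 4 x.2 := .mem 4 .v0
  exact (Does.fill 5 (f := fun a j => a.mem 4 j) h3).seq (.fill 4 h2)

theorem nextWord_frame (a : RamState) : Frame {4, 5} a (nextWord a) := by
  refine ⟨fun r _ => ?_, fun b hb => ?_⟩
  · rw [nextWord, fill_reg, fill_reg]
  · simp only [Set.mem_insert_iff, Set.mem_singleton_iff, not_or] at hb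
    rw [nextWord, fill_mem_of_ne _ _ _ hb.1, fill_mem_of_ne _ _ _ hb.2]

theorem nextWord_reg (a : RamState) : (nextWord a).reg = a.reg := by
  rw [nextWord, fill_reg, fill_reg]

theorem nextWord_mem (a : RamState) {B t : ℕ} (hB : 0 < B) (h5 : a.reg 5 = B)
    (ha : ∀ j < a.reg 0, a.mem 4 j = digit B t j) {j : ℕ} (hj : j < a.reg 0) :
    (nextWord a).mem 4 j = digit B (t + 1) j := by
  -- While bank `4` is overwritten, carries are read off the copy in bank `5`, which stays fixed.
  have e5 : ∀ i < a.reg 0, ∀ k,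
      (fillTo 4 incDigit (fill 5 (fun a j => a.mem 4 j) a) k).mem 5 i = digit B t i := by
    intro i hi k
    rw [fillTo_mem_of_ne _ _ _ _ (by decide), fill_mem _ _ _ hi,
      fillTo_mem_of_ne _ _ _ _ (by decide), ha i hi]
  rw [nextWord, fill_mem _ _ _ (by rw [fill_reg]; exact hj), incDigit, fillTo_reg, fill_reg,
    digit_inc hB, e5 j hj, h5]
  refine if_congr ⟨fun h i hi => ?_, fun h i hi hij => ?_⟩ rfl rfl
  · rw [← e5 i (by omega) j]; exact h i (by omega) hi
  · rw [e5 i hi]; exact h i hij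

open Classical in
/-- One round of the search for a word that satisfies `φ` after the preparation `prep`. The flag
is set to `1` on success and to `2` when all words have been tried. -/
noncomputable def searchStep (prep : RamState → RamState) (φ : RamState → Prop) (a : RamState) :
    RamState :=
  if φ (prep a) then (prep a).setReg 6 1
  else if ∀ j < a.reg 0, j < a.reg 4 → a.mem 4 j + 1 = a.reg 5 then (prep a).setReg 6 2
  else nextWord (prep a)

/-- The preparation changes only the memory banks in `s`, and neither the flag nor the word. -/
def Prepares (s : Set ℕ) (prep : RamState → RamState) : Prop :=
  ∀ a, (prep a).reg = a.reg ∧ (prep a).mem 4 = a.mem 4 ∧ ∀ b, b ∉ s → (prep a).mem b = a.mem b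

theorem Does.searchStep {s : Set ℕ} {prep : RamState → RamState} {φ : RamState → Prop}
    (hs : Prepares s prep) (hp : Does prep) (hφ : CompP φ) : Does (searchStep prep φ) := by
  classical
  have h1 : CompP fun a : RamState => ∀ j < a.reg 0, j < a.reg 4 → a.mem 4 j + 1 = a.reg 5 :=
    .all (p := fun (a : RamState) j => j < a.reg 4 → a.mem 4 j + 1 = a.reg 5)
      (.imp (.lt .v0 (.global 4 (by decide)))
        (.eq (.succ (.mem 4 .v0)) (.global 5 (by decide))))
  have h2 := hp.seq (.ite hφ (.assign 6 (by decide) (by decide) (.const 1))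
    (.ite h1 (.assign 6 (by decide) (by decide) (.const 2)) .nextWord))
  refine (congrArg Does (funext fun a => ?_)).mp h2
  simp only [(hs a).1, (hs a).2.1, _root_.searchStep]

/-- The loop that searches through all words of length `reg 4` over the alphabet of size `reg 5`:
it needs at most as many rounds as there are words, and either finds a word or makes sure that
there is none. -/
theorem search_spec {s : Set ℕ} {prep : RamState → RamState} {φ : RamState → Prop}
    (hs : Prepares s prep) (h4 : 4 ∈ s) (h5 : 5 ∈ s) {a : RamState} (hb : a.reg 4 ≤ a.reg 0)
    (hB : 0 < a.reg 5 ∨ a.reg 4 = 0) (h6 : a.reg 6 = 0) (hw : ∀ j < a.reg 0, a.mem 4 j = 0) :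
    ∃ N ≤ a.reg 5 ^ a.reg 4, (∀ i < N, ((searchStep prep φ)^[i] a).reg 6 = 0 ∧
        Frame s a ((searchStep prep φ)^[i] a)) ∧
      ∃ a', Frame s a a' ∧
        (((searchStep prep φ)^[N] a = (prep a').setReg 6 1 ∧ φ (prep a')) ∨
        ((searchStep prep φ)^[N] a = (prep a').setReg 6 2 ∧
          ∀ w : ℕ → ℕ, (∀ j < a.reg 4, w j < a.reg 5) → ∃ a'', Frame s a a'' ∧
            (∀ j < a.reg 4, a''.mem 4 j = w j) ∧ ¬ φ (prep a''))) := by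
  classical
  set B := a.reg 5 with hBdef
  set M := a.reg 4 with hMdef
  let x : ℕ → RamState := fun i => (searchStep prep φ)^[i] a
  have hx : ∀ i, x (i + 1) = searchStep prep φ (x i) := fun i =>
    Function.iterate_succ_apply' _ _ _
  -- Round `t` tests the word of the base-`B` digits of `t`; it is the last word exactly when `B ^
  -- M` divides `t + 1`.
  let halts : ℕ → Prop := fun t => φ (prep (x t)) ∨ B ^ M ∣ t + 1
  have hhalts : ∃ t, halts t := ⟨B ^ M - 1, Or.inr (by
    have : 0 < B ^ M := by
      rcases hB with h | h
      · exact Nat.pow_pos h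
      · rw [h]; simp
    rw [Nat.sub_add_cancel this])⟩
  let N := Nat.find hhalts
  have hN : ∀ t < N, ¬ φ (prep (x t)) ∧ ¬ B ^ M ∣ t + 1 :=
    fun t ht => not_or.1 (Nat.find_min hhalts ht)
  have hpos : 0 < B ^ M := by
    rcases hB with h | h
    · exact Nat.pow_pos h
    · rw [h]; simp
  have hNle : N + 1 ≤ B ^ M := by
    have : N ≤ B ^ M - 1 := Nat.find_min' hhalts (Or.inr (by rw [Nat.sub_add_cancel hpos]))
    omega
  have inv : ∀ t ≤ N, Frame s a (x t) ∧ (x t).reg 6 = 0 ∧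
      ∀ j < a.reg 0, (x t).mem 4 j = digit B t j := by
    intro t
    induction t with
    | zero => exact fun _ => ⟨Frame.refl _ _, h6, fun j hj => by rw [digit_zero]; exact hw j hj⟩
    | succ t ih =>
      intro ht
      obtain ⟨hf, hf6, hd⟩ := ih (by omega)
      obtain ⟨n1, n2⟩ := hN t (by omega)
      -- An empty alphabet means `M = 0`, and then the search would have stopped at its only word.
      have hB' : 0 < B := by
        rcases hB with h | h
        · exact h
        · exact absurd (by rw [h]; simp) n2
      have r0 : (x t).reg 0 = a.reg 0 := hf.1 0 (by decide)
      have r4 : (x t).reg 4 = M := hf.1 4 (by decide)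
      have r5 : (x t).reg 5 = B := hf.1 5 (by decide)
      have n3 : ¬ ∀ j < (x t).reg 0, j < (x t).reg 4 → (x t).mem 4 j + 1 = (x t).reg 5 := by
        rw [r0, r4, r5]
        intro h
        refine n2 ((all_digit_iff M hB t).1 fun j hj => ?_)
        rw [← hd j (by omega)]
        exact h j (by omega) hj
      have e : x (t + 1) = nextWord (prep (x t)) := by
        rw [hx, searchStep, if_neg n1, if_neg n3]
      have hp := hs (x t)
      refine ⟨?_, ?_, fun j hj => ?_⟩
      · rw [e]
        refine hf.trans (Frame.trans (b := prep (x t))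
          ⟨fun r _ => by rw [hp.1], fun i hi => hp.2.2 i hi⟩
          ⟨(nextWord_frame _).1, fun i hi => (nextWord_frame _).2 i ?_⟩)
        simp only [Set.mem_insert_iff, Set.mem_singleton_iff, not_or]
        exact ⟨fun h => hi (h ▸ h4), fun h => hi (h ▸ h5)⟩
      · rw [e, nextWord_reg, hp.1, hf6]
      · rw [e]
        refine nextWord_mem _ hB' (by rw [hp.1, r5]) (fun j hj => ?_) (by rw [hp.1, r0]; exact hj)
        rw [hp.1, r0] at hj
        rw [hp.2.1, hd j hj]
  refine ⟨N + 1, hNle, fun i hi => ⟨(inv i (by omega)).2.1, (inv i (by omega)).1⟩, x N,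
    (inv N le_rfl).1, ?_⟩
  change (x (N + 1) = _ ∧ _) ∨ (x (N + 1) = _ ∧ _)
  rw [hx, searchStep]
  by_cases hφ : φ (prep (x N))
  · exact Or.inl ⟨if_pos hφ, hφ⟩
  right
  obtain ⟨hf, hf6, hd⟩ := inv N le_rfl
  have hdvd : B ^ M ∣ N + 1 := (Nat.find_spec hhalts).resolve_left hφ
  -- A failed search has gone through all numbers below `B ^ M`, hence through all words.
  have hNeq : N + 1 = B ^ M := le_antisymm hNle (Nat.le_of_dvd (Nat.succ_pos _) hdvd)
  have r0 : (x N).reg 0 = a.reg 0 := hf.1 0 (by decide)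
  have r4 : (x N).reg 4 = M := hf.1 4 (by decide)
  have r5 : (x N).reg 5 = B := hf.1 5 (by decide)
  refine ⟨?_, fun w hwd => ?_⟩
  · rw [if_neg hφ, if_pos]
    rw [r0, r4, r5]
    intro j hj hjM
    rw [hd j hj]
    exact (all_digit_iff M hB N).2 hdvd j hjM
  · obtain ⟨t, ht, e⟩ := exists_digits B M w hwd
    have htN : t ≤ N := by omega
    refine ⟨x t, (inv t htN).1, fun j hj => ?_, ?_⟩
    · rw [(inv t htN).2.2 j (by omega), e j hj]
    · rcases htN.lt_or_eq with h | rfl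
      · exact (hN t h).1
      · exact hφ

/-- Running the search loop. -/
theorem exec_search {s : Set ℕ} {prep : RamState → RamState} {φ : RamState → Prop}
    {P : RamProgram} {q : Polynomial ℕ} (hs : Prepares s prep) (h4 : 4 ∈ s) (h5 : 5 ∈ s)
    (hP : ∀ a, Exec numGlobals numGlobals P a (searchStep prep φ a) (q.eval (a.reg 0)))
    {a : RamState} (hb : a.reg 4 ≤ a.reg 0) (hB : 0 < a.reg 5 ∨ a.reg 4 = 0) (h6 : a.reg 6 = 0)
    (h7 : a.reg 7 = 1) (hw : ∀ j < a.reg 0, a.mem 4 j = 0) :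
    ∃ a' v, Frame s a a' ∧ Exec numGlobals numGlobals (.loop (.lt 6 7) P) a ((prep a').setReg 6 v)
        (a.reg 5 ^ a.reg 4 * (q.eval (a.reg 0) + 1) + 1) ∧
      ((v = 1 ∧ φ (prep a')) ∨ (v = 2 ∧
          ∀ w : ℕ → ℕ, (∀ j < a.reg 4, w j < a.reg 5) → ∃ a'', Frame s a a'' ∧
            (∀ j < a.reg 4, a''.mem 4 j = w j) ∧ ¬ φ (prep a''))) := by
  obtain ⟨N, hN, hlt, a', hf, hor⟩ := search_spec (φ := φ) hs h4 h5 hb hB h6 hw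
  have h7' : ∀ v, ((prep a').setReg 6 v).reg 7 = 1 := by
    intro v
    rw [RamState.setReg_reg_of_ne _ (by decide), (hs a').1, hf.1 7 (by decide), h7]
  -- Since register `7` holds `1`, the flag `0` continues the loop, and both outcomes `1` and `2`
  -- end it.
  have ex : ∀ v, (searchStep prep φ)^[N] a = (prep a').setReg 6 v → 1 ≤ v →
      Exec numGlobals numGlobals (.loop (.lt 6 7) P) a ((prep a').setReg 6 v)
        (a.reg 5 ^ a.reg 4 * (q.eval (a.reg 0) + 1) + 1) := by
    intro v e hv
    rw [← e]
    refine (Exec.loop (c := .lt 6 7) ⟨by decide, by decide⟩ (q.eval (a.reg 0)) N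
      (fun i => (searchStep prep φ)^[i] a) (fun i hi => ⟨?_, ?_⟩) ?_).mono ?_
    · simp only [RamTest.Holds]
      rw [(hlt i hi).1, (hlt i hi).2.1 7 (by decide), h7]
      exact Nat.zero_lt_one
    · have := hP ((searchStep prep φ)^[i] a)
      rw [(hlt i hi).2.1 0 (by decide)] at this
      simp only [Function.iterate_succ_apply']
      exact this
    · simp only [RamTest.Holds, e, h7', RamState.setReg_reg_self]
      omega
    · exact Nat.add_le_add_right (Nat.mul_le_mul_right _ hN) _
  rcases hor with ⟨e, h⟩ | ⟨e, h⟩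
  · exact ⟨a', 1, hf, ex 1 e le_rfl, Or.inl ⟨rfl, h⟩⟩
  · exact ⟨a', 2, hf, ex 2 e (by decide), Or.inr ⟨rfl, h⟩⟩

/-- The loop for the modulator is unrolled round by round, as the bound at which a search succeeds
is not known beforehand. -/
theorem Exec.loop_step {k : ℕ} {P : RamProgram} {c : RamTest} (hc : c.Below k) {a a' a'' : RamState}
    {T T' : ℕ} (h : c.Holds a) (h1 : Exec k k P a a' T) (h2 : Exec k k (.loop c P) a' a'' T') :
    Exec k k (.loop c P) a a'' (1 + T + T') := by
  intro s hs
  obtain ⟨s1, t1, r1, b1, g1⟩ := h1 s hs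
  obtain ⟨s2, t2, r2, b2, g2⟩ := h2 s1 g1
  exact ⟨s2, _, .loop_true ((RamTest.holds_iff hc hs).2 h) r1 r2, by omega, g2⟩

theorem Exec.loop_done {k : ℕ} {P : RamProgram} {c : RamTest} (hc : c.Below k) {a : RamState}
    (h : ¬ c.Holds a) : Exec k k (.loop c P) a a 1 :=
  fun s hs => ⟨s, 1, .loop_false (fun h' => h ((RamTest.holds_iff hc hs).1 h')), le_rfl, hs⟩

/-! ### The search for a modulator and the search for a guess. -/

/-- The store holds the instance `I`, and register `7` holds the constant `1`. -/
structure Loaded (I : MHVInstance) (a : RamState) : Prop where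
  reg : ∀ r < 4, a.reg r = I.encode.reg r
  one : a.reg 7 = 1
  adj : a.mem 0 = I.encode.mem 0
  col : a.mem 1 = I.encode.mem 1

namespace Loaded
variable {I : MHVInstance} {a : RamState}

theorem reg_zero (h : Loaded I a) : a.reg 0 = I.n := by
  rw [h.reg 0 (by decide)]; simp [MHVInstance.encode]

theorem data_eq (h : Loaded I a) :
    a.data = ({ I.encode.data with b := a.reg 4 } : Data).setSW (a.mem 3) (a.mem 4) := by
  simp only [RamState.data, Data.setSW, h.reg 0 (by decide), h.adj, h.col]

theorem goal_eq (h : Loaded I a) : a.goal = I.encode.goal := by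
  simp only [RamState.goal, h.reg 2 (by decide), h.reg 3 (by decide)]

theorem frame {s : Set ℕ} {a' : RamState} (h : Loaded I a) (hf : Frame s a a') (h0 : 0 ∉ s)
    (h1 : 1 ∉ s) : Loaded I a' :=
  ⟨fun r hr => (hf.1 r (by omega)).trans (h.reg r hr), (hf.1 7 (by decide)).trans h.one,
    (hf.2 0 h0).trans h.adj, (hf.2 1 h1).trans h.col⟩

theorem prep {s : Set ℕ} {p : RamState → RamState} (h : Loaded I a) (hp : Prepares s p) (h0 : 0 ∉ s)
    (h1 : 1 ∉ s) : Loaded I (p a) :=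
  h.frame (s := s) ⟨fun r _ => by rw [(hp a).1], (hp a).2.2⟩ h0 h1

theorem setReg (h : Loaded I a) {r : ℕ} (hr : 4 ≤ r) (hr7 : r ≠ 7) (v : ℕ) :
    Loaded I (a.setReg r v) :=
  ⟨fun j hj => (RamState.setReg_reg_of_ne _ (by omega) _).trans (h.reg j hj),
    (RamState.setReg_reg_of_ne _ hr7.symm _).trans h.one, h.adj, h.col⟩

end Loaded

/-- Start the enumeration of words over an alphabet of size `B`. -/
def initSearch (B : RamState → ℕ) (a : RamState) : RamState :=
  ((fill 4 (fun _ _ => 0) a).setReg 6 0).setReg 5 (B a)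

theorem initSearch_reg (B : RamState → ℕ) (a : RamState) {r : ℕ} (h5 : r ≠ 5) (h6 : r ≠ 6) :
    (initSearch B a).reg r = a.reg r := by
  rw [initSearch, RamState.setReg_reg_of_ne _ h5, RamState.setReg_reg_of_ne _ h6, fill_reg]

theorem initSearch_reg_five (B : RamState → ℕ) (a : RamState) : (initSearch B a).reg 5 = B a := by
  rw [initSearch, RamState.setReg_reg_self]

theorem initSearch_reg_six (B : RamState → ℕ) (a : RamState) : (initSearch B a).reg 6 = 0 := by
  rw [initSearch, RamState.setReg_reg_of_ne _ (by decide), RamState.setReg_reg_self]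

theorem initSearch_mem_of_ne (B : RamState → ℕ) (a : RamState) {b : ℕ} (h : b ≠ 4) :
    (initSearch B a).mem b = a.mem b := by
  rw [initSearch, RamState.setReg_mem, RamState.setReg_mem, fill_mem_of_ne _ _ _ h]

theorem initSearch_word (B : RamState → ℕ) (a : RamState) {j : ℕ} (h : j < a.reg 0) :
    (initSearch B a).mem 4 j = 0 := by
  rw [initSearch, RamState.setReg_mem, RamState.setReg_mem, fill_mem _ _ _ h]

theorem Loaded.initSearch {I : MHVInstance} {a : RamState} (h : Loaded I a) (B : RamState → ℕ) :
    Loaded I (initSearch B a) :=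
  ⟨fun r hr => (initSearch_reg B a (by omega) (by omega)).trans (h.reg r hr),
    (initSearch_reg B a (by decide) (by decide)).trans h.one,
    (initSearch_mem_of_ne B a (by decide)).trans h.adj,
    (initSearch_mem_of_ne B a (by decide)).trans h.col⟩

/-- The alphabet size is computed after the word and the flag have been reset, so it may depend only
on what the reset leaves alone; registers `0` and `4` suffice. -/
theorem Does.initSearch {B : RamState → ℕ} (hB : Comp B)
    (hB' : ∀ a a' : RamState, a'.reg 0 = a.reg 0 → a'.reg 4 = a.reg 4 → B a' = B a) :
    Does (initSearch B) := by
  refine (congrArg Does (funext fun a => ?_)).mp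
    (((Does.fill 4 (f := fun _ _ => 0) (.const 0)).seq
      (.assign 6 (by decide) (by decide) (.const 0))).seq (.assign 5 (by decide) (by decide) hB))
  rw [_root_.initSearch, hB' a]
  · rw [RamState.setReg_reg_of_ne _ (by decide), fill_reg]
  · rw [RamState.setReg_reg_of_ne _ (by decide), fill_reg]

/-- List the vertices that the word picks from induced paths. -/
noncomputable def pickAll : RamState → RamState := fill 3 fun a j => a.data.pick j

theorem prepares_pickAll : Prepares {3, 4, 5} pickAll := fun a => by
  refine ⟨fill_reg _ _ _, fill_mem_of_ne _ _ _ (by decide), fun b hb => fill_mem_of_ne _ _ _ ?_⟩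
  simp only [Set.mem_insert_iff, Set.mem_singleton_iff, not_or] at hb
  exact hb.1

theorem prepares_id : Prepares {4, 5} id := fun _ => ⟨rfl, rfl, fun _ _ => rfl⟩

theorem Does.pickAll : Does pickAll :=
  .fill 3 (show Comp fun x : RamState × ℕ => (dat x).pick x.2 from .pick .v0)

theorem compP_p3Free : CompP fun a : RamState => a.data.P3Free a.data.b :=
  show CompP fun a : RamState => (dat a).P3Free (dat a).b from .p3Free .dataB

theorem compP_good : CompP fun a : RamState => a.data.Good (a.reg 1) a.goal :=
  show CompP fun a : RamState => (dat a).Good ((base a).reg 1)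
    (if (base a).reg 2 = 1 then 0 else (base a).reg 3) from
  .good (.global 1 (by decide)) (.ite (.eq (.global 2 (by decide)) (.const 1)) (.const 0)
    (.global 3 (by decide)))

/-- The vertices that are listed by `pickAll`. -/
theorem pickAll_spec {I : MHVInstance} {a : RamState} (h : Loaded I a) {j : ℕ}
    (hj : j < I.n) : (pickAll a).mem 3 j =
      (({ I.encode.data with b := a.reg 4 } : Data).setSW ((pickAll a).mem 3) (a.mem 4)).pick j := by
  have hj0 : j < a.reg 0 := by rw [h.reg_zero]; exact hj
  set f : RamState → ℕ → ℕ := fun a j => a.data.pick j with hf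
  have hl : Loaded I (fillTo 3 f a j) :=
    ⟨fun r hr => by rw [fillTo_reg]; exact h.reg r hr, by rw [fillTo_reg]; exact h.one,
      by rw [fillTo_mem_of_ne _ _ _ _ (by decide)]; exact h.adj,
      by rw [fillTo_mem_of_ne _ _ _ _ (by decide)]; exact h.col⟩
  have e1 : (pickAll a).mem 3 j = (fillTo 3 f a j).data.pick j := fill_mem 3 f a hj0
  rw [e1, hl.data_eq, fillTo_reg, fillTo_mem_of_ne 3 f a j (show 4 ≠ 3 by decide)]
  -- Cell `j` is computed when exactly the cells below `j` have been filled, and those are all that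
  -- the pick depends on.
  refine Data.pick_congr (fun i hi => ?_) rfl
  rw [fillTo_mem _ _ _ hi]
  exact (fill_mem 3 f a (show i < a.reg 0 by omega)).symm

/-- If the current bound is the distance to cluster graphs, some word picks a modulator. -/
theorem exists_word_modulator {I : MHVInstance} {a : RamState} (h : Loaded I a)
    (hb : a.reg 4 = distToCluster I.G) :
    ∃ w : ℕ → ℕ, (∀ j < a.reg 4, w j < 3) ∧ ∀ a', Frame {3, 4, 5} a a' →
      (∀ j < a.reg 4, a'.mem 4 j = w j) → (pickAll a').data.P3Free (pickAll a').data.b := by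
  obtain ⟨X, hX, hP⟩ := I.exists_modulator
  have hle : a.reg 4 ≤ I.n := by rw [hb]; exact I.distToCluster_le
  obtain ⟨w, hw, hfree⟩ := Data.exists_word_p3Free
    (D := { I.encode.data with b := a.reg 4 }) (X := X)
    (show a.reg 4 ≤ I.encode.data.n by rw [I.encode_n]; exact hle) (by rw [hX, hb]) hP
  refine ⟨w, hw, fun a' hf hw' => ?_⟩
  have hl := h.frame hf (by simp) (by simp)
  have hl' := hl.prep prepares_pickAll (by simp) (by simp)
  have e4 : a'.reg 4 = a.reg 4 := hf.1 4 (by decide)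
  have e4' : (pickAll a').reg 4 = a.reg 4 := by rw [(prepares_pickAll a').1, e4]
  have hfin := hfree ((pickAll a').mem 3) (a'.mem 4) hw' fun j hj => by
    have := pickAll_spec hl (lt_of_lt_of_le hj hle)
    rw [e4] at this
    exact this
  rw [hl'.data_eq, e4', (prepares_pickAll a').2.1]
  exact hfin

/-- Only yes-instances have a good coloring. -/
theorem Loaded.isYes {I : MHVInstance} {a : RamState} (h : Loaded I a)
    (hg : a.data.Good (a.reg 1) a.goal) : I.IsYes := by
  have e1 : a.reg 1 = I.ℓ := by rw [h.reg 1 (by decide)]; simp [MHVInstance.encode]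
  have en : a.data.n = I.n := h.reg_zero
  rw [h.goal_eq, e1] at hg
  refine I.isYes_iff.2 ⟨a.data.col, fun v hv => hg.1 v (by rw [en]; exact hv), fun v hv hp => ?_, ?_⟩
  · have e2 : a.data.p = I.encode.data.p := h.col
    rw [← e2] at hp ⊢
    -- The construction keeps all precolors, whatever the guess.
    rw [Data.col, if_pos hp]
  · have e3 : I.encode.data.Happy a.data.col = a.data.Happy a.data.col := by
      rw [h.data_eq]; rfl
    rw [e3, ← en]
    exact hg.2

/-- On yes-instances some word leads to a good coloring. -/
theorem Loaded.exists_word {I : MHVInstance} {a : RamState} (h : Loaded I a)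
    (hb : a.reg 4 ≤ I.n) (hf : a.data.P3Free a.data.b) (hy : I.IsYes) :
    ∃ w : ℕ → ℕ, (∀ j < a.reg 4, w j < a.reg 4 + a.reg 4) ∧ ∀ a', Frame {4, 5} a a' →
      (∀ j < a.reg 4, a'.mem 4 j = w j) → a'.data.Good (a'.reg 1) a'.goal := by
  obtain ⟨c, h1, h2, h3⟩ := I.isYes_iff.1 hy
  have en : a.data.n = I.n := h.reg_zero
  have e2 : a.data.p = I.encode.data.p := h.col
  have ea : a.data.adj = I.encode.data.adj := by rw [h.data_eq]; rfl
  have e3 : a.data.Happy c = I.encode.data.Happy c := by rw [h.data_eq]; rfl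
  have hsymm : ∀ u v, a.data.adj u v → a.data.adj v u := by
    rw [ea]
    intro u v huv
    obtain ⟨hu, hv, hadj⟩ := (I.encode_adj u v).1 huv
    exact (I.encode_adj v u).2 ⟨hv, hu, hadj.symm⟩
  have hlt : ∀ u v, a.data.adj u v → u < a.data.n := fun _ _ huv => huv.1
  obtain ⟨w, hw, hg⟩ := Data.exists_word_good (D := a.data) (c := c) (l := I.ℓ)
    (m := I.encode.goal) hsymm hlt (by rw [en]; exact hb) hf (by rw [en]; exact h1)
    (by rw [en, e2]; exact h2) (by rw [en, e3]; exact h3)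
  refine ⟨w, hw, fun a' hfr hw' => ?_⟩
  have hl := h.frame hfr (by simp) (by simp)
  have e1 : a'.reg 1 = I.ℓ := by rw [hl.reg 1 (by decide)]; simp [MHVInstance.encode]
  have := hg (a'.mem 4) hw'
  rw [hl.goal_eq, e1, hl.data_eq, hfr.1 4 (by decide), hfr.2 3 (by simp)]
  rw [h.data_eq] at this
  exact this

/-- The increment of the bound on the size of the modulator after a failed search. -/
def raiseBound (a : RamState) : RamState := if a.reg 6 = 1 then a else a.setReg 4 (a.reg 4 + 1)

theorem Does.raiseBound : Does raiseBound :=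
  .ite (.eq (.global 6 (by decide)) (.const 1)) .skip
    (.assign 4 (by decide) (by decide) (.succ (.global 4 (by decide))))

/-- The loop that finds a modulator. -/
theorem exec_modulator {I : MHVInstance} {Q₁ P Q₂ : RamProgram} {q₁ q q₂ : Polynomial ℕ}
    (h₁ : ∀ a, Exec numGlobals numGlobals Q₁ a (initSearch (fun _ => 3) a) (q₁.eval (a.reg 0)))
    (hP : ∀ a, Exec numGlobals numGlobals P a
      (searchStep pickAll (fun a => a.data.P3Free a.data.b) a) (q.eval (a.reg 0)))
    (h₂ : ∀ a, Exec numGlobals numGlobals Q₂ a (raiseBound a) (q₂.eval (a.reg 0))) (m : ℕ) :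
    ∀ a, Loaded I a → a.reg 4 + m = distToCluster I.G → a.reg 6 ≠ 1 →
    ∃ a', Exec numGlobals numGlobals
        (.loop (.ne 6 7) (.seq (.seq Q₁ (.loop (.lt 6 7) P)) Q₂)) a a'
        ((m + 1) * (q₁.eval I.n + (3 ^ distToCluster I.G * (q.eval I.n + 1) + 1) +
          q₂.eval I.n + 1) + 1) ∧
      Loaded I a' ∧ a'.reg 4 ≤ distToCluster I.G ∧ a'.data.P3Free a'.data.b := by
  have hc : (RamTest.ne 6 7).Below numGlobals := ⟨by decide, by decide⟩
  -- Here `m` is the distance minus the current bound, so it drops with each failed search.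
  induction m using Nat.strong_induction_on with
  | _ m ih =>
    intro a ha hd h6
    have hle := I.distToCluster_le
    have i0 : (initSearch (fun _ => 3) a).reg 0 = I.n := by
      rw [initSearch_reg _ _ (by decide) (by decide), ha.reg_zero]
    have i4 : (initSearch (fun _ => 3) a).reg 4 = a.reg 4 :=
      initSearch_reg _ _ (by decide) (by decide)
    have hl := ha.initSearch fun _ => 3
    obtain ⟨a', v, hf, he, hor⟩ := exec_search (a := initSearch (fun _ => 3) a) prepares_pickAll
      (by simp) (by simp) hP (by rw [i0, i4]; omega)
      (by rw [initSearch_reg_five]; exact Or.inl (by decide)) (initSearch_reg_six _ _)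
      hl.one (fun j hj => initSearch_word _ _ (by rw [i0, ← ha.reg_zero] at hj; exact hj))
    have hl' := hl.frame hf (by simp) (by simp)
    have hl2 := (hl'.prep prepares_pickAll (by simp) (by simp)).setReg (r := 6) (by decide)
      (by decide) v
    have f4 : ((pickAll a').setReg 6 v).reg 4 = a.reg 4 := by
      rw [RamState.setReg_reg_of_ne _ (by decide), (prepares_pickAll a').1, hf.1 4 (by decide), i4]
    rw [i0, i4, initSearch_reg_five] at he
    have hbody := ((h₁ a).seq he).seq (h₂ _)
    rw [ha.reg_zero, hl2.reg_zero] at hbody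
    -- Every bound tried is at most the distance, so `3 ^ distToCluster I.G` covers the number of
    -- words.
    have hbody' := hbody.mono (T' := q₁.eval I.n + (3 ^ distToCluster I.G * (q.eval I.n + 1) + 1) +
          q₂.eval I.n) (by gcongr <;> omega)
    have htest : (RamTest.ne 6 7).Holds a := by
      simp only [RamTest.Holds, ha.one]; exact h6
    rcases hor with ⟨rfl, hφ⟩ | ⟨rfl, hno⟩
    · have er : raiseBound ((pickAll a').setReg 6 1) = (pickAll a').setReg 6 1 := by
        rw [raiseBound, if_pos (RamState.setReg_reg_self _ _ _)]
      rw [er] at hbody'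
      refine ⟨_, (Exec.loop_step hc htest hbody' (Exec.loop_done hc ?_)).mono ?_, hl2, ?_, ?_⟩
      · simp only [RamTest.Holds, hl2.one, RamState.setReg_reg_self]; decide
      · simp only [Nat.add_mul]; omega
      · rw [f4]; omega
      · exact hφ
    · rcases Nat.eq_zero_or_pos m with rfl | hm
      -- The bound has reached the distance, where a failed search is impossible.
      · obtain ⟨w, hw, hgood⟩ := exists_word_modulator hl (by rw [i4, ← hd, Nat.add_zero])
        obtain ⟨a'', hf', hw', hn⟩ := hno w (by rw [initSearch_reg_five]; exact hw)
        exact absurd (hgood a'' hf' hw') hn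
      · have er : raiseBound ((pickAll a').setReg 6 2) =
            ((pickAll a').setReg 6 2).setReg 4 (a.reg 4 + 1) := by
          rw [raiseBound, if_neg (by rw [RamState.setReg_reg_self]; decide), f4]
        rw [er] at hbody'
        obtain ⟨a₃, e₃, g1, g2, g3⟩ := ih (m - 1) (by omega)
          (((pickAll a').setReg 6 2).setReg 4 (a.reg 4 + 1))
          (hl2.setReg (by decide) (by decide) _) (by rw [RamState.setReg_reg_self]; omega)
          (by rw [RamState.setReg_reg_of_ne _ (by decide), RamState.setReg_reg_self]; decide)
        refine ⟨a₃, (Exec.loop_step hc htest hbody' e₃).mono ?_, g1, g2, g3⟩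
        rw [Nat.sub_add_cancel hm, Nat.add_mul m 1]
        omega

/-- The loop that solves the instance with a given modulator. -/
theorem exec_solve {I : MHVInstance} {P : RamProgram} {q : Polynomial ℕ}
    (hP : ∀ a, Exec numGlobals numGlobals P a
      (searchStep id (fun a => a.data.Good (a.reg 1) a.goal) a) (q.eval (a.reg 0)))
    {a : RamState} (ha : Loaded I a) (hb : a.reg 4 ≤ I.n) (hf : a.data.P3Free a.data.b) :
    ∃ a' v, Exec numGlobals numGlobals (.loop (.lt 6 7) P)
        (initSearch (fun a => a.reg 4 + min (a.reg 4) (a.reg 0)) a) a'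
        ((a.reg 4 + a.reg 4) ^ a.reg 4 * (q.eval I.n + 1) + 1) ∧ a'.reg 6 = v ∧ a'.reg 7 = 1 ∧
      ((v = 1 ∧ I.IsYes) ∨ (v = 2 ∧ ¬ I.IsYes)) := by
  set B : RamState → ℕ := fun a => a.reg 4 + min (a.reg 4) (a.reg 0) with hB
  have hBa : B a = a.reg 4 + a.reg 4 := by
    simp only [hB, ha.reg_zero, min_eq_left hb]
  have i0 : (initSearch B a).reg 0 = I.n := by
    rw [initSearch_reg _ _ (by decide) (by decide), ha.reg_zero]
  have i4 : (initSearch B a).reg 4 = a.reg 4 := initSearch_reg _ _ (by decide) (by decide)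
  have i5 : (initSearch B a).reg 5 = a.reg 4 + a.reg 4 := by rw [initSearch_reg_five, hBa]
  have hl := ha.initSearch B
  -- Resetting the word leaves the list `S` in bank `3` intact.
  have hfree : (initSearch B a).data.P3Free (initSearch B a).data.b := by
    rw [ha.data_eq] at hf
    rw [hl.data_eq, i4, initSearch_mem_of_ne _ _ (by decide)]
    exact (Data.p3Free_congr fun _ _ => rfl).1 hf
  obtain ⟨a', v, hfr, he, hor⟩ := exec_search (a := initSearch B a) prepares_id
    (by simp) (by simp) hP (by rw [i0, i4]; exact hb) (by rw [i4, i5]; omega)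
    (initSearch_reg_six _ _) hl.one
    (fun j hj => initSearch_word _ _ (by rw [i0, ← ha.reg_zero] at hj; exact hj))
  have hl' := hl.frame hfr (by simp) (by simp)
  rw [i0, i4, i5] at he
  refine ⟨_, v, he, RamState.setReg_reg_self _ _ _, (hl'.setReg (by decide) (by decide) _).one, ?_⟩
  rcases hor with ⟨rfl, hφ⟩ | ⟨rfl, hno⟩
  · exact Or.inl ⟨rfl, hl'.isYes hφ⟩
  · refine Or.inr ⟨rfl, fun hy => ?_⟩
    obtain ⟨w, hw, hgood⟩ := hl.exists_word (by rw [i4]; exact hb) hfree hy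
    obtain ⟨a'', hf', hw', hn⟩ := hno w (by rw [i5]; rw [i4] at hw ⊢; exact hw)
    exact hn (hgood a'' hf' hw')

/-- From `d = 2` on already `3 ≤ 2 * d`; the factor is needed only for `d = 1`. -/
theorem three_pow_le (d : ℕ) : 3 ^ d ≤ 3 * (2 * d) ^ d := by
  rcases d with _ | _ | d
  · norm_num
  · norm_num
  · have : 3 ^ (d + 2) ≤ (2 * (d + 2)) ^ (d + 2) := Nat.pow_le_pow_left (by omega) _
    exact this.trans (Nat.le_mul_of_pos_left _ (by decide))

theorem add_self_pow_le {b d : ℕ} (h : b ≤ d) : (b + b) ^ b ≤ (2 * d) ^ d := by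
  rcases d with _ | d
  · simp [Nat.le_zero.1 h]
  · exact (Nat.pow_le_pow_left (by omega) _).trans (Nat.pow_le_pow_right (by omega) h)

theorem two_mul_pow_pos (d : ℕ) : 1 ≤ (2 * d) ^ d := by
  simpa using add_self_pow_le (Nat.zero_le d)

theorem mainTheorem6 :
    ∃ (P : RamProgram) (q : Polynomial ℕ),
      P.DecidesWithin MHVInstance.encode MHVInstance.IsYes
        (fun I => (2 * distToCluster I.G) ^ distToCluster I.G * q.eval I.n) := by
  obtain ⟨Q₁, q₁, h₁⟩ := Does.initSearch (B := fun _ => 3) (.const 3) fun _ _ _ _ => rfl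
  obtain ⟨P₁, p₁, g₁⟩ := Does.searchStep prepares_pickAll .pickAll compP_p3Free
  obtain ⟨Q₂, q₂, h₂⟩ := Does.raiseBound
  obtain ⟨Q₃, q₃, h₃⟩ := Does.initSearch (B := fun a => a.reg 4 + min (a.reg 4) (a.reg 0))
    (.min_add (.global 4 (by decide)) (.global 4 (by decide))) fun a a' e e' => by rw [e, e']
  obtain ⟨P₂, p₂, g₂⟩ := Does.searchStep prepares_id .skip compP_good
  refine ⟨.seq (.seq (.seq (.seq (.const 7 1)
      (.loop (.ne 6 7) (.seq (.seq Q₁ (.loop (.lt 6 7) P₁)) Q₂))) Q₃) (.loop (.lt 6 7) P₂))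
      (.branch (.eq 6 7) (.const 0 1) (.const 0 0)),
    -- The factor `.X + 1` counts the bounds from `0` to the distance, which is at most `n`; the
    -- last `2` pays for the final test and the answer.
    1 + ((.X + 1) * (q₁ + (3 * (p₁ + 1) + 1) + q₂ + 1) + 1) + q₃ + ((p₂ + 1) + 1) + 2,
    fun I => ?_⟩
  have hl : Loaded I (I.encode.setReg 7 1) :=
    ⟨fun r hr => RamState.setReg_reg_of_ne _ (by omega) _, RamState.setReg_reg_self _ _ _, rfl, rfl⟩
  obtain ⟨a, e1, ha, hab, hfree⟩ := exec_modulator (I := I) (fun a => (h₁ a).1)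
    (fun a => (g₁ a).1) (fun a => (h₂ a).1) (distToCluster I.G) _ hl
    (by rw [RamState.setReg_reg_of_ne _ (by decide)]; simp [MHVInstance.encode])
    (by rw [RamState.setReg_reg_of_ne _ (by decide)]; simp [MHVInstance.encode])
  have hd := I.distToCluster_le
  obtain ⟨a', v, e2, r6, r7, hor⟩ := exec_solve (I := I) (fun a => (g₂ a).1) ha (by omega) hfree
  have e0 : Exec numGlobals numGlobals (.const 7 1) I.encode (I.encode.setReg 7 1) 1 :=
    fun s hs => ⟨_, 1, .const s 7 1, le_rfl, hs.setReg 7 1⟩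
  have e3 := ((e0.seq e1).seq (h₃ a).1).seq e2
  rw [ha.reg_zero] at e3
  obtain ⟨s, t, hr, ht, hs⟩ := e3 I.encode (Agree.refl _ _)
  have s6 : s.reg 6 = v := (hs.1 6 (by decide)).trans r6
  have s7 : s.reg 7 = 1 := (hs.1 7 (by decide)).trans r7
  have htime : t + 2 ≤ (2 * distToCluster I.G) ^ distToCluster I.G *
      (1 + ((.X + 1) * (q₁ + (3 * (p₁ + 1) + 1) + q₂ + 1) + 1) + q₃ + ((p₂ + 1) + 1) + 2 :
        Polynomial ℕ).eval I.n := by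
    have b1 := three_pow_le (distToCluster I.G)
    have b2 := add_self_pow_le hab
    have b3 := two_mul_pow_pos (distToCluster I.G)
    -- As this power is at least `1`, also for distance `0`, terms without it can be multiplied by
    -- it.
    generalize (2 * distToCluster I.G) ^ distToCluster I.G = E at b1 b2 b3 ⊢
    simp only [Polynomial.eval_add, Polynomial.eval_mul, Polynomial.eval_one, Polynomial.eval_X,
      Polynomial.eval_ofNat]
    generalize q₁.eval I.n = x₁ at *
    generalize q₂.eval I.n = x₂ at *
    generalize q₃.eval I.n = x₃ at *
    generalize p₁.eval I.n = y₁ at *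
    generalize p₂.eval I.n = y₂ at *
    have c1 : 3 ^ distToCluster I.G * (y₁ + 1) ≤ E * (3 * (y₁ + 1)) :=
      (Nat.mul_le_mul_right _ b1).trans (by rw [← Nat.mul_assoc, Nat.mul_comm E 3])
    have c2 : ∀ x, x ≤ E * x := fun x => Nat.le_mul_of_pos_left x b3
    have c3 : x₁ + (3 ^ distToCluster I.G * (y₁ + 1) + 1) + x₂ + 1 ≤
        E * (x₁ + (3 * (y₁ + 1) + 1) + x₂ + 1) := by
      have := c2 x₁; have := c2 x₂; have := c2 1
      simp only [Nat.mul_add] at c1 ⊢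
      omega
    have c4 : (distToCluster I.G + 1) *
        (x₁ + (3 ^ distToCluster I.G * (y₁ + 1) + 1) + x₂ + 1) ≤
        E * ((I.n + 1) * (x₁ + (3 * (y₁ + 1) + 1) + x₂ + 1)) := by
      rw [Nat.mul_left_comm]
      exact Nat.mul_le_mul (by omega) c3
    have c5 : (a.reg 4 + a.reg 4) ^ a.reg 4 * (y₂ + 1) ≤ E * (y₂ + 1) :=
      Nat.mul_le_mul_right _ b2
    have c6 := c2 1
    have c7 := c2 (y₂ + 1)
    have c8 := c2 x₃
    generalize hY : (a.reg 4 + a.reg 4) ^ a.reg 4 * (y₂ + 1) = Y at *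
    generalize (I.n + 1) * (x₁ + (3 * (y₁ + 1) + 1) + x₂ + 1) = Z at *
    generalize (distToCluster I.G + 1) *
        (x₁ + (3 ^ distToCluster I.G * (y₁ + 1) + 1) + x₂ + 1) = Z' at *
    simp only [Nat.mul_add] at c5 ⊢
    omega
  rcases hor with ⟨rfl, hy⟩ | ⟨rfl, hy⟩
  · refine ⟨_, _, .seq hr (.branch_true ?_ (.const s 0 1)), htime, fun _ => ?_, fun h => absurd hy h⟩
    · simp only [RamTest.Holds, s6, s7]
    · simp
  · refine ⟨_, _, .seq hr (.branch_false ?_ (.const s 0 0)), htime, fun h => absurd h hy, fun _ => ?_⟩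
    · simp only [RamTest.Holds, s6, s7]; decide
    · simp
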